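/- Let $G$ be a two-player zero-sum concurrent stochastic game with a finite set $S$ of $n$ states, finite nonempty action sets $A$ (Player 1) and $A'$ (Player 2), and transition function $\delta$ assigning to each $(s,a,b)$ a probability distribution on $S$. Let $r\colon S\times A\times A'\to\mathbb{R}$ be a reward function. For a discount function $\Lambda\colon S\to(0,1]$, the payoff of a play $(s_t,a_t,b_t)_{t\ge 0}$ is $$\mathrm{Disc}_\Lambda=\sum_{t\ge 0}\Lambda(s_t)\Big(\prod_{j<t}(1-\Lambda(s_j))\Big)\,r(s_t,a_t,b_t),$$ and $\mathrm{val}_\Lambda(s)=\sup_\sigma\inf_\tau \mathbb{E}_s^{\sigma,\tau}[\mathrm{Disc}_\Lambda]$, where $\sigma,\tau$ range over all randomized history-dependent strategies. Let $\chi\colon S\to\{1,\dots,d\}$ be an assignment function; discount factors $\lambda_1,\dots,\lambda_d$ define $\Lambda(s)=\lambda_{\chi(s)}$, and $$\mathrm{val}_\chi(s)=\lim_{\lambda_1\to0^+}\cdots\lim_{\lambda_d\to0^+}\mathrm{val}_\Lambda(s)$$ (the innermost limit is the one in $\lambda_d$). Let $\mathrm{bit}(k)=\lceil\log_2(k+1)\rceil$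 for an integer $k\ge 0$, and $\mathrm{bit}(k_1/k_2)=\mathrm{bit}(k_1)+\mathrm{bit}(k_2)$ for a positive rational in lowest terms. Let $\mathrm{B}\ge 0$ be an integer and suppose that the data have bit-size $\mathrm{B}$ in the following sense: for every state $s$, the numbers $\delta(s,a,b)(s')$ (over all $a,b,s'$) are fractions with a common denominator, with numerators and denominator at most $2^{\mathrm{B}}$ in absolute value, and likewise the numbers $r(s,a,b)$ (over all $a,b$) are fractions with a common denominator, with numerators and denominator at most $2^{\mathrm{B}}$ in absolute value. (This covers the case where all data are in $\{0,2^{-\mathrm{B}},2\cdot2^{-\mathrm{B}},\dots,1\}$.) Let $\varepsilon>0$ be rational. Let $D=\max(|A|^n,|A'|^n)$ be the maximum of the numbers of pure stationary strategies of the two players, let $$\mathrm{B}_1=11Dn\big(\mathrm{B}+\mathrm{bit}(n)+\mathrm{bit}(D)+\mathrm{bit}(\varepsilon)\big),$$ set $\lambda^0_i=\exp\!\big(-\mathrm{B}_1(nD+1)^{i-1}\big)$ for $1\le i\le d$, and $\Lambda^0(s)=\lambda^0_{\chi(s)}$. Then for every state $s$ the limit value $\mathrm{val}_\chi(s)$ exists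 and $$|\mathrm{val}_{\Lambda^0}(s)-\mathrm{val}_\chi(s)|\le\varepsilon .$$ -/

import Mathlib

open MeasureTheory ProbabilityTheory Filter Topology

noncomputable section

/-- A concurrent stochastic game with state space `S`, action set `A` of Player 1 and action set `B`
of Player 2: at state `s`, the players simultaneously choose `a` and `b`, and the next state is
drawn from `δ s a b`. -/
structure CSG (S A B : Type*) where
  /-- the transition function -/
  δ : S → A → B → PMF S

/-- One stage of a play: the current state and the two actions chosen there. -/
def Step (S A B : Type*) : Type _ := S × A × B

namespace Step

variable {S A B : Type*}

/-- The state of a stage. -/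
def state (x : Step S A B) : S := x.1

/-- The action of Player 1 at a stage. -/
def act1 (x : Step S A B) : A := x.2.1

/-- The action of Player 2 at a stage. -/
def act2 (x : Step S A B) : B := x.2.2

instance : MeasurableSpace (Step S A B) := ⊤

instance : DiscreteMeasurableSpace (Step S A B) := ⟨fun _ => trivial⟩

instance [Finite S] [Finite A] [Finite B] : Finite (Step S A B) :=
  inferInstanceAs (Finite (S × A × B))

end Step

namespace CSG

variable {S A B : Type*}

/-- A (behavioural, history-dependent) strategy of a player with action set `C`: the list of all
past stages (oldest first) and the current state are mapped to a distribution on `C`. -/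
abbrev Strategy (S A B C : Type*) := List (Step S A B) → S → PMF C

/-- The law of the current stage, given the past `h` and the current state `s`: the two actions are
drawn independently from the strategies. -/
def stageLaw (σ : Strategy S A B A) (τ : Strategy S A B B) (h : List (Step S A B)) (s : S) :
    PMF (Step S A B) :=
  (σ h s).bind fun a => (τ h s).map fun b => ((s, a, b) : S × A × B)

/-- The law of the next stage, given the past `h` and the current stage `x`. -/
def nextLaw (G : CSG S A B) (σ : Strategy S A B A) (τ : Strategy S A B B)
    (h : List (Step S A B)) (x : Step S A B) : PMF (Step S A B) :=
  (G.δ x.state x.act1 x.act2).bind fun s' => stageLaw σ τ (h ++ [x]) s'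

variable [Finite S] [Finite A] [Finite B]

/-- The law of stage `t + 1` given the stages `0, …, t`, as a Markov kernel. -/
def nextKernel (G : CSG S A B) (σ : Strategy S A B A) (τ : Strategy S A B B) (t : ℕ) :
    Kernel (∀ _ : Finset.Iic t, Step S A B) (Step S A B) :=
  Kernel.ofFunOfCountable fun x =>
    (G.nextLaw σ τ (List.ofFn fun i : Fin t => x ⟨i, Finset.mem_Iic.2 i.isLt.le⟩)
      (x ⟨t, Finset.mem_Iic.2 le_rfl⟩)).toMeasure

instance (G : CSG S A B) (σ : Strategy S A B A) (τ : Strategy S A B B) (t : ℕ) :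
    IsMarkovKernel (G.nextKernel σ τ t) :=
  ⟨fun _ => PMF.toMeasure.isProbabilityMeasure _⟩

/-- The probability measure on infinite plays that the strategies `σ`, `τ` induce from the initial
state `s`. -/
def playMeasure (G : CSG S A B) (σ : Strategy S A B A) (τ : Strategy S A B B) (s : S) :
    Measure (ℕ → Step S A B) :=
  Kernel.trajMeasure (X := fun _ => Step S A B) (stageLaw σ τ [] s).toMeasure (G.nextKernel σ τ)

/-- The stateful-discounted payoff of a play, for the discount function `Λ`:
`∑ t, Λ(s_t) ∏_{j<t} (1 - Λ(s_j)) r(s_t, a_t, b_t)`. -/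
def discounted (r : S → A → B → ℝ) (Λ : S → ℝ) (ω : ℕ → Step S A B) : ℝ :=
  ∑' t : ℕ, Λ (ω t).state * (∏ j ∈ Finset.range t, (1 - Λ (ω j).state)) *
    r (ω t).state (ω t).act1 (ω t).act2

/-- The stateful-discounted value `val_Λ(s)`. -/
def value (G : CSG S A B) (r : S → A → B → ℝ) (Λ : S → ℝ) (s : S) : ℝ :=
  ⨆ σ : Strategy S A B A, ⨅ τ : Strategy S A B B,
    ∫ ω, discounted r Λ ω ∂(G.playMeasure σ τ s)

end CSG

/-- `IsIteratedLimit d f v` says that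
`lim_{x₁ → 0⁺} lim_{x₂ → 0⁺} ⋯ lim_{x_d → 0⁺} f (x₁, …, x_d)` exists and equals `v`;
the innermost limit is the one in the last variable. -/
def IsIteratedLimit : (d : ℕ) → ((Fin d → ℝ) → ℝ) → ℝ → Prop
  | 0, f, v => f Fin.elim0 = v
  | d + 1, f, v => ∃ g : ℝ → ℝ,
      (∀ᶠ x in 𝓝[>] (0 : ℝ), IsIteratedLimit d (fun y => f (Fin.cons x y)) (g x)) ∧
      Tendsto g (𝓝[>] 0) (𝓝 v)

theorem IsIteratedLimit.unique : ∀ {d : ℕ} {f : (Fin d → ℝ) → ℝ} {v w : ℝ},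
    IsIteratedLimit d f v → IsIteratedLimit d f w → v = w
  | 0, _, _, _, hv, hw => hv.symm.trans hw
  | _ + 1, _, _, _, ⟨_, hg, hv⟩, ⟨_, hg', hw⟩ =>
      tendsto_nhds_unique_of_eventuallyEq hv hw
        (by filter_upwards [hg, hg'] with x hx hx' using IsIteratedLimit.unique hx hx')

namespace CSG

variable {S A B : Type*} [Finite S] [Finite A] [Finite B]

/-- `v` is the limit value `val_χ(s) = lim_{λ₁ → 0⁺} ⋯ lim_{λ_d → 0⁺} val_Λ(s)`, where
`Λ(s') = λ_{χ(s')}`. -/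
def IsLimitValue (G : CSG S A B) (r : S → A → B → ℝ) {d : ℕ} (χ : S → Fin d) (s : S) (v : ℝ) :
    Prop :=
  IsIteratedLimit d (fun lam => G.value r (fun s' => lam (χ s')) s) v

end CSG

/-- The bit-size `⌈log₂ (k + 1)⌉` of a natural number. -/
def bit (k : ℕ) : ℕ := Nat.clog 2 (k + 1)

/-- The bit-size of a rational: that of its numerator plus that of its denominator. -/
def bitRat (x : ℚ) : ℕ := bit x.num.natAbs + bit x.den

/-- The numbers `f i` are rationals represented with bit-size `b`: over a common denominator, with
numerators and denominator bounded by `2 ^ b`. -/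
def HasBitSize {ι : Type*} (b : ℕ) (f : ι → ℝ) : Prop :=
  ∃ q : ℕ, 0 < q ∧ q ≤ 2 ^ b ∧ ∀ i, ∃ k : ℤ, |k| ≤ 2 ^ b ∧ f i = k / q

/-- The number of pure stationary strategies of a player with action set `C`. -/
def numPureStationary (S C : Type*) : ℕ := Nat.card (S → C)

/-- `D = max (|Σ^PS|, |Γ^PS|)`. -/
def stratBound (S A B : Type*) : ℕ := max (numPureStationary S A) (numPureStationary S B)

/-- `B₁ = 11 D n (b + bit n + bit D + bit ε)`, where `n` is the number of states. -/
def expBound (S A B : Type*) (b : ℕ) (ε : ℚ) : ℕ :=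
  11 * stratBound S A B * Nat.card S *
    (b + bit (Nat.card S) + bit (stratBound S A B) + bitRat ε)

/-- The discount factors `λ⁰_i = exp (-B₁ (n D + 1) ^ (i - 1))` for `i = 1, …, d`; in the code the
index `i : Fin d` starts at `0`. -/
def discountFactors (S A B : Type*) (b : ℕ) (ε : ℚ) {d : ℕ} (i : Fin d) : ℝ :=
  Real.exp (-((expBound S A B b ε : ℝ) *
    ((Nat.card S : ℝ) * (stratBound S A B : ℝ) + 1) ^ (i : ℕ)))

end

/-! For a fixed `Λ`, Shapley's fixed point gives the value together with optimal stationary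
strategies. By Cramer's rule the payoff of a stationary pair is a quotient of determinants with
positive denominator, and these determinants are multilinear in the mixed actions at the different
states. Hence `z ≤ val_Λ(k)` exactly when the rows of `gameMatrix`, a matrix indexed by pure
stationary strategies, have a nonzero nonnegative combination that is itself nonnegative
(`IsShapleySolution.le_iff`). An extreme ray of the cone of such combinations is a vector of
cofactors, so the signs of the minors decide the question
(`Matrix.HasNonnegCombination.of_sign_minors_eq`).

The minors are polynomials in the discount factors. For the relevant rational `z`, after clearing
denominators, they have integer coefficients, degree at most `n D` in each variable and absolute
coefficient sum below `exp B₁`. Where each factor is at most `exp (-B₁)` times the `n D`-th powers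
of all earlier ones, a single monomial dominates throughout, so the sign is constant
(`sign_eval_eq_of_mem_smallRegion`).

The point `λ⁰` lies in this region, and the iterated limit is eventually taken inside it. So
`val_{Λ⁰}` and `val_χ` lie in one closed interval between consecutive multiples of `1 / ε.den`,
which is at most `ε`. Existence of the limit uses the same sign argument with an arbitrary real `z`:
the value cannot oscillate around any level. -/

open MeasureTheory ProbabilityTheory Filter Topology

/-! ### Matrix games and the Shapley equations -/

/-- Von Neumann's minimax theorem for matrix games, in saddle point form. -/
theorem exists_matrixGame_value {A B : Type*} [Fintype A] [Fintype B] [Nonempty A] [Nonempty B]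
    (M : A → B → ℝ) :
    ∃ v : ℝ, ∃ x ∈ stdSimplex ℝ A, ∃ y ∈ stdSimplex ℝ B,
      (∀ b, v ≤ ∑ a, x a * M a b) ∧ ∀ a, ∑ b, y b * M a b ≤ v := by
  classical
  let f : (B → ℝ) → (A → ℝ) → ℝ := fun y x => ∑ a, x a * ∑ b, y b * M a b
  have hcvx : ∀ x, ConvexOn ℝ (stdSimplex ℝ B) fun y => f y x := fun x => by
    refine ⟨convex_stdSimplex ℝ B, fun y₁ _ y₂ _ s t _ _ _ => le_of_eq ?_⟩
    simp only [f, Pi.add_apply, Pi.smul_apply, smul_eq_mul, add_mul, Finset.sum_add_distrib,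
      mul_add, Finset.mul_sum]
    congr 1 <;> exact Finset.sum_congr rfl fun a _ => Finset.sum_congr rfl fun b _ => by ring
  have hccv : ∀ y, ConcaveOn ℝ (stdSimplex ℝ A) fun x => f y x := fun y => by
    refine ⟨convex_stdSimplex ℝ A, fun x₁ _ x₂ _ s t _ _ _ => le_of_eq ?_⟩
    simp only [f, Pi.add_apply, Pi.smul_apply, smul_eq_mul, add_mul, Finset.sum_add_distrib,
      Finset.mul_sum]
    congr 1 <;> exact Finset.sum_congr rfl fun a _ => Finset.sum_congr rfl fun b _ => by ring
  obtain ⟨y, hy, x, hx, h⟩ := Sion.exists_isSaddlePointOn (f := f)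
    (X := stdSimplex ℝ B) (Y := stdSimplex ℝ A)
    ⟨_, single_mem_stdSimplex ℝ (Classical.arbitrary B)⟩
    (convex_stdSimplex ℝ B) (isCompact_stdSimplex ℝ B)
    (fun x _ => (Continuous.lowerSemicontinuous (by fun_prop)).lowerSemicontinuousOn _)
    (fun x _ => (hcvx x).quasiconvexOn)
    (convex_stdSimplex ℝ A) ⟨_, single_mem_stdSimplex ℝ (Classical.arbitrary A)⟩
    (isCompact_stdSimplex ℝ A)
    (fun y _ => (Continuous.upperSemicontinuous (by fun_prop)).upperSemicontinuousOn _)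
    (fun y _ => (hccv y).quasiconcaveOn)
  refine ⟨f y x, x, hx, y, hy, fun b => ?_, fun a => ?_⟩
  -- The saddle inequalities, tested at the vertices of the simplices.
  · simpa [f, Pi.single_apply] using h _ (single_mem_stdSimplex ℝ b) _ hx
  · simpa [f, Pi.single_apply] using h _ hy _ (single_mem_stdSimplex ℝ a)

theorem sum_mul_le_of_mem_stdSimplex {A : Type*} [Fintype A] {x : A → ℝ}
    (hx : x ∈ stdSimplex ℝ A) {g : A → ℝ} {c : ℝ} (h : ∀ a, g a ≤ c) : ∑ a, x a * g a ≤ c :=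
  calc ∑ a, x a * g a ≤ ∑ a, x a * c :=
        Finset.sum_le_sum fun a _ => mul_le_mul_of_nonneg_left (h a) (hx.1 a)
    _ = c := by rw [← Finset.sum_mul, hx.2, one_mul]

theorem le_sum_mul_of_mem_stdSimplex {A : Type*} [Fintype A] {x : A → ℝ}
    (hx : x ∈ stdSimplex ℝ A) {g : A → ℝ} {c : ℝ} (h : ∀ a, c ≤ g a) : c ≤ ∑ a, x a * g a :=
  calc c = ∑ a, x a * c := by rw [← Finset.sum_mul, hx.2, one_mul]
    _ ≤ ∑ a, x a * g a :=
        Finset.sum_le_sum fun a _ => mul_le_mul_of_nonneg_left (h a) (hx.1 a)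

/-- A guarantee of Player 1 in one matrix game exceeds a guarantee of Player 2 in another one by at
most the largest difference of the entries. -/
theorem matrixGame_guarantee_le {A B : Type*} [Fintype A] [Fintype B] {M M' : A → B → ℝ}
    {x : A → ℝ} (hx : x ∈ stdSimplex ℝ A) {y : B → ℝ} (hy : y ∈ stdSimplex ℝ B) {v v' c : ℝ}
    (hv : ∀ b, v ≤ ∑ a, x a * M a b) (hv' : ∀ a, ∑ b, y b * M' a b ≤ v')
    (h : ∀ a b, M a b ≤ M' a b + c) : v ≤ v' + c := by
  calc v ≤ ∑ b, y b * ∑ a, x a * M a b := le_sum_mul_of_mem_stdSimplex hy hv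
    _ = ∑ a, x a * ∑ b, y b * M a b := by
        simp only [Finset.mul_sum]
        rw [Finset.sum_comm]
        exact Finset.sum_congr rfl fun a _ => Finset.sum_congr rfl fun b _ => by ring
    _ ≤ v' + c := sum_mul_le_of_mem_stdSimplex hx fun a => by
        calc ∑ b, y b * M a b ≤ ∑ b, y b * (M' a b + c) :=
              Finset.sum_le_sum fun b _ => mul_le_mul_of_nonneg_left (h a b) (hy.1 b)
          _ = ∑ b, y b * M' a b + c := by
              simp only [mul_add, Finset.sum_add_distrib, ← Finset.sum_mul, hy.2, one_mul]
          _ ≤ v' + c := by linarith [hv' a]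

/-- The payoff of the one-shot game at a state of a discounted stochastic game with transition
probabilities `p`, when the continuation payoffs are `w`. -/
def shapleyMatrix {S A B : Type*} [Fintype S] (p : S → A → B → S → ℝ) (r : S → A → B → ℝ)
    (Λ : S → ℝ) (w : S → ℝ) (s : S) (a : A) (b : B) : ℝ :=
  Λ s * r s a b + (1 - Λ s) * ∑ s', p s a b s' * w s'

/-- `w` is the vector of values of a discounted stochastic game, and `x`, `y` are stationary
strategies that are optimal in all one-shot games. -/
structure IsShapleySolution {S A B : Type*} [Fintype S] [Fintype A] [Fintype B]
    (p : S → A → B → S → ℝ) (r : S → A → B → ℝ) (Λ : S → ℝ) (w : S → ℝ) (x : S → A → ℝ)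
    (y : S → B → ℝ) : Prop where
  mem_left : ∀ s, x s ∈ stdSimplex ℝ A
  mem_right : ∀ s, y s ∈ stdSimplex ℝ B
  left : ∀ s b, w s ≤ ∑ a, x s a * shapleyMatrix p r Λ w s a b
  right : ∀ s a, ∑ b, y s b * shapleyMatrix p r Λ w s a b ≤ w s

/-- The one-shot value operator is a contraction with factor `1 - min Λ`; Banach's fixed point is
`w`. -/
theorem exists_isShapleySolution {S A B : Type*} [Fintype S] [Fintype A] [Fintype B] [Nonempty A]
    [Nonempty B] {p : S → A → B → S → ℝ} (hp : ∀ s a b, p s a b ∈ stdSimplex ℝ S)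
    (r : S → A → B → ℝ) {Λ : S → ℝ} (hΛ : ∀ s, 0 < Λ s) (hΛ' : ∀ s, Λ s ≤ 1) :
    ∃ w x y, IsShapleySolution p r Λ w x y := by
  choose val x hx y hy hval hval' using fun (w : S → ℝ) (s : S) =>
    exists_matrixGame_value (shapleyMatrix p r Λ w s)
  obtain ⟨c, hc0, hc⟩ : ∃ c : ℝ, 0 < c ∧ ∀ s, c ≤ Λ s := by
    rcases isEmpty_or_nonempty S with h | h
    · exact ⟨1, one_pos, fun s => h.elim s⟩
    · obtain ⟨s₀, hs₀⟩ := Finite.exists_min Λ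
      exact ⟨Λ s₀, hΛ s₀, hs₀⟩
  have hle : ∀ w w' s, val w s ≤ val w' s + (1 - c) * dist w w' := by
    intro w w' s
    refine matrixGame_guarantee_le (hx w s) (hy w' s) (hval w s) (hval' w' s) fun a b => ?_
    have h1 : ∑ s', p s a b s' * w s' ≤ ∑ s', p s a b s' * w' s' + dist w w' := by
      have := sum_mul_le_of_mem_stdSimplex (hp s a b) (g := fun s' => w s' - w' s')
        (c := dist w w') fun s' => (le_abs_self _).trans (by
          rw [← Real.dist_eq]; exact dist_le_pi_dist w w' s')
      simp only [mul_sub, Finset.sum_sub_distrib] at this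
      linarith
    have h2 := mul_le_mul_of_nonneg_left h1 (sub_nonneg.2 (hΛ' s))
    have h3 := mul_le_mul_of_nonneg_right (sub_le_sub_left (hc s) 1) (dist_nonneg (x := w) (y := w'))
    unfold shapleyMatrix
    linarith
  have hcontr : ContractingWith (1 - c).toNNReal val := by
    refine ⟨by rw [Real.toNNReal_lt_one]; linarith, LipschitzWith.of_dist_le_mul fun w w' => ?_⟩
    have hK : (1 - c) * dist w w' ≤ ((1 - c).toNNReal : ℝ) * dist w w' :=
      mul_le_mul_of_nonneg_right (Real.le_coe_toNNReal _) dist_nonneg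
    refine (dist_pi_le_iff (by positivity)).2 fun s => ?_
    have h1 := hle w w' s
    have h2 := hle w' w s
    rw [dist_comm w' w] at h2
    rw [Real.dist_eq, abs_le]
    constructor <;> linarith
  have hfix : val hcontr.fixedPoint = hcontr.fixedPoint := hcontr.fixedPoint_isFixedPt
  set w := hcontr.fixedPoint
  refine ⟨w, x w, y w, hx w, hy w, fun s b => ?_, fun s a => ?_⟩
  · exact (congrFun hfix s).symm.trans_le (hval w s b)
  · exact (hval' w s a).trans_eq (congrFun hfix s)

/-- Maximum principle: at a state maximizing `w` the continuation payoff is at most `w` there, which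
leaves `Λ w ≤ Λ M`; dually at a minimum. -/
theorem IsShapleySolution.abs_value_le {S A B : Type*} [Fintype S] [Fintype A] [Fintype B] [Nonempty A]
    [Nonempty B] {p : S → A → B → S → ℝ} (hp : ∀ s a b, p s a b ∈ stdSimplex ℝ S)
    {r : S → A → B → ℝ} {Λ : S → ℝ} (hΛ : ∀ s, 0 < Λ s) (hΛ' : ∀ s, Λ s ≤ 1)
    {w : S → ℝ} {x : S → A → ℝ} {y : S → B → ℝ} (h : IsShapleySolution p r Λ w x y)
    {M : ℝ} (hM : ∀ s a b, |r s a b| ≤ M) (s : S) : |w s| ≤ M := by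
  have : Nonempty S := ⟨s⟩
  obtain ⟨s₁, hs₁⟩ := Finite.exists_max w
  obtain ⟨s₂, hs₂⟩ := Finite.exists_min w
  have h₁ : w s₁ ≤ M := by
    have := (h.left s₁ (Classical.arbitrary B)).trans (sum_mul_le_of_mem_stdSimplex (h.mem_left s₁)
      (c := Λ s₁ * M + (1 - Λ s₁) * w s₁) fun a => add_le_add
        (mul_le_mul_of_nonneg_left (abs_le.1 (hM _ _ _)).2 (hΛ s₁).le)
        (mul_le_mul_of_nonneg_left (sum_mul_le_of_mem_stdSimplex (hp _ _ _) hs₁)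
          (sub_nonneg.2 (hΛ' s₁))))
    have : Λ s₁ * w s₁ ≤ Λ s₁ * M := by linarith
    exact le_of_mul_le_mul_left this (hΛ s₁)
  have h₂ : -M ≤ w s₂ := by
    have := (le_sum_mul_of_mem_stdSimplex (h.mem_right s₂)
      (c := Λ s₂ * (-M) + (1 - Λ s₂) * w s₂) fun b => add_le_add
        (mul_le_mul_of_nonneg_left (abs_le.1 (hM _ _ _)).1 (hΛ s₂).le)
        (mul_le_mul_of_nonneg_left (le_sum_mul_of_mem_stdSimplex (hp _ _ _) hs₂)
          (sub_nonneg.2 (hΛ' s₂)))).trans (h.right s₂ (Classical.arbitrary A))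
    have : Λ s₂ * -M ≤ Λ s₂ * w s₂ := by linarith
    exact le_of_mul_le_mul_left this (hΛ s₂)
  exact abs_le.2 ⟨h₂.trans (hs₂ s), (hs₁ s).trans h₁⟩

/-! ### Expectations over plays: the Shapley solution is the value -/

theorem PMF.integral_bind {α β : Type*} [Fintype α] [Fintype β] [MeasurableSpace β]
    [MeasurableSingletonClass β] (p : PMF α) (q : α → PMF β) (g : β → ℝ) :
    ∫ x, g x ∂(p.bind q).toMeasure = ∑ a, (p a).toReal * ∫ x, g x ∂(q a).toMeasure := by
  simp only [PMF.integral_eq_sum, PMF.bind_apply, tsum_fintype, smul_eq_mul]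
  have : ∀ x, (∑ a, p a * q a x).toReal = ∑ a, (p a).toReal * (q a x).toReal := fun x => by
    rw [ENNReal.toReal_sum fun a _ => ENNReal.mul_ne_top (p.apply_ne_top a) ((q a).apply_ne_top x)]
    simp only [ENNReal.toReal_mul]
  simp only [this, Finset.sum_mul, Finset.mul_sum]
  rw [Finset.sum_comm]
  exact Finset.sum_congr rfl fun a _ => Finset.sum_congr rfl fun b _ => by ring

theorem PMF.integral_pure {β : Type*} [Fintype β] [MeasurableSpace β]
    [MeasurableSingletonClass β] (b : β) (g : β → ℝ) :
    ∫ x, g x ∂(PMF.pure b).toMeasure = g b := by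
  rw [PMF.toMeasure_pure, integral_dirac]

theorem PMF.toReal_mem_stdSimplex {α : Type*} [Fintype α] (p : PMF α) :
    (fun a => (p a).toReal) ∈ stdSimplex ℝ α := by
  refine ⟨fun a => ENNReal.toReal_nonneg, ?_⟩
  rw [← ENNReal.toReal_sum fun a _ => p.apply_ne_top a, ← tsum_fintype (L := .unconditional α),
    p.tsum_coe, ENNReal.toReal_one]

namespace CSG

variable {S A B : Type*}

theorem integral_stageLaw [Fintype S] [Fintype A] [Fintype B]
    (σ : Strategy S A B A) (τ : Strategy S A B B) (h : List (Step S A B)) (s : S)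
    (g : Step S A B → ℝ) :
    ∫ x, g x ∂(stageLaw σ τ h s).toMeasure =
      ∑ a, (σ h s a).toReal * ∑ b, (τ h s b).toReal * g (s, a, b) := by
  classical
  have : Fintype (Step S A B) := inferInstanceAs (Fintype (S × A × B))
  unfold stageLaw
  rw [PMF.integral_bind]
  refine Finset.sum_congr rfl fun a _ => ?_
  congr 1
  exact (PMF.integral_bind (β := Step S A B) (τ h s) (fun b => PMF.pure (s, a, b)) g).trans
    (Finset.sum_congr rfl fun b _ => congrArg _ (PMF.integral_pure (β := Step S A B) _ _))

theorem integral_stageLaw_state [Fintype S] [Fintype A] [Fintype B]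
    (σ : Strategy S A B A) (τ : Strategy S A B B) (h : List (Step S A B)) (s : S) (g : S → ℝ) :
    ∫ x, g x.state ∂(stageLaw σ τ h s).toMeasure = g s := by
  rw [integral_stageLaw]
  simp [Step.state, ← Finset.sum_mul, (PMF.toReal_mem_stdSimplex _).2]

/-- The weight of the payoff at stage `t`, up to the discount factor of that stage. -/
def discountWeight (Λ : S → ℝ) (t : ℕ) (ω : ℕ → Step S A B) : ℝ :=
  ∏ j ∈ Finset.range t, (1 - Λ (ω j).state)

variable {Λ : S → ℝ}

/-- The weight of stage `t + 1` is a function of stages `0, …, t`, so it factors out when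
conditioning on them. -/
theorem discountWeight_succ_eq (t : ℕ) (ω : ℕ → Step S A B) :
    discountWeight Λ (t + 1) ω = ∏ i : Finset.Iic t,
      (1 - Λ (Preorder.frestrictLe (π := fun _ => Step S A B) t ω i).state) := by
  unfold discountWeight
  rw [Nat.range_succ_eq_Iic]
  exact (Finset.prod_coe_sort (Finset.Iic t) fun i => (1 - Λ (ω i).state)).symm

theorem measurable_discountWeight (t : ℕ) :
    Measurable (discountWeight (A := A) (B := B) Λ t) :=
  Finset.measurable_prod _ fun j _ =>
    (Measurable.of_discrete (f := fun x : Step S A B => 1 - Λ x.state)).comp (measurable_pi_apply j)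

theorem discountWeight_nonneg (hΛ' : ∀ s, Λ s ≤ 1) (t : ℕ) (ω : ℕ → Step S A B) :
    0 ≤ discountWeight Λ t ω :=
  Finset.prod_nonneg fun _ _ => sub_nonneg.2 (hΛ' _)

theorem discountWeight_le_pow (hΛ' : ∀ s, Λ s ≤ 1) {c : ℝ} (hc : ∀ s, c ≤ Λ s) (t : ℕ)
    (ω : ℕ → Step S A B) : discountWeight Λ t ω ≤ (1 - c) ^ t := by
  refine (Finset.prod_le_prod (fun j _ => sub_nonneg.2 (hΛ' _))
    fun j _ => sub_le_sub_left (hc _) 1).trans_eq ?_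
  rw [Finset.prod_const, Finset.card_range]

theorem abs_discountWeight_mul_le (hΛ' : ∀ s, Λ s ≤ 1) {c : ℝ} (hc : ∀ s, c ≤ Λ s)
    {g : Step S A B → ℝ} {M : ℝ} (hM : ∀ x, |g x| ≤ M) (t : ℕ) (ω : ℕ → Step S A B) (k : ℕ) :
    ‖discountWeight Λ t ω * g (ω k)‖ ≤ (1 - c) ^ t * M := by
  rw [norm_mul, Real.norm_eq_abs, Real.norm_eq_abs, abs_of_nonneg (discountWeight_nonneg hΛ' t ω)]
  exact mul_le_mul (discountWeight_le_pow hΛ' hc t ω) (hM _) (abs_nonneg _)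
    ((discountWeight_nonneg hΛ' t ω).trans (discountWeight_le_pow hΛ' hc t ω))

variable [Fintype S] [Fintype A] [Fintype B] (G : CSG S A B)
    (σ : Strategy S A B A) (τ : Strategy S A B B) (s : S)

instance : IsProbabilityMeasure (G.playMeasure σ τ s) := by
  unfold playMeasure; infer_instance

theorem integral_nextKernel (t : ℕ) (z : ∀ _ : Finset.Iic t, Step S A B) (g : Step S A B → ℝ) :
    ∫ x, g x ∂G.nextKernel σ τ t z =
      ∑ s', (G.δ (z ⟨t, by simp⟩).state (z ⟨t, by simp⟩).act1 (z ⟨t, by simp⟩).act2 s').toReal *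
        ∫ x, g x ∂(stageLaw σ τ ((List.ofFn fun i : Fin t => z ⟨i, by simp [i.isLt.le]⟩) ++
          [z ⟨t, by simp⟩]) s').toMeasure := by
  have : Fintype (Step S A B) := inferInstanceAs (Fintype (S × A × B))
  exact PMF.integral_bind _ _ _

theorem integral_playMeasure_zero (g : Step S A B → ℝ) :
    ∫ ω, g (ω 0) ∂G.playMeasure σ τ s = ∫ x, g x ∂(stageLaw σ τ [] s).toMeasure := by
  have h : (G.playMeasure σ τ s).map (Preorder.frestrictLe (π := fun _ => Step S A B) 0) =
      (stageLaw σ τ [] s).toMeasure.map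
        (MeasurableEquiv.piUnique fun _ : Finset.Iic 0 => Step S A B).symm := by
    unfold playMeasure Kernel.trajMeasure
    rw [Measure.map_comp _ _ (by fun_prop), Kernel.traj_map_frestrictLe,
      Kernel.partialTraj_self, Measure.id_comp]
  have h2 := integral_map (μ := G.playMeasure σ τ s)
    (φ := Preorder.frestrictLe (π := fun _ => Step S A B) 0) (by fun_prop)
    (f := fun z => g (z ⟨0, by simp⟩)) (Measurable.of_discrete.aestronglyMeasurable)
  rw [h, integral_map (by fun_prop) (Measurable.of_discrete.aestronglyMeasurable)] at h2
  exact h2.symm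

/-- Conditioning on the past: given stages `0, …, t`, the next stage has the law of the kernel, and
the past-measurable factor `c` is untouched. -/
theorem integral_playMeasure_succ (t : ℕ) (c : (∀ _ : Finset.Iic t, Step S A B) → ℝ)
    (g : Step S A B → ℝ) :
    ∫ ω, c (Preorder.frestrictLe (π := fun _ => Step S A B) t ω) * g (ω (t + 1))
        ∂G.playMeasure σ τ s =
      ∫ ω, c (Preorder.frestrictLe (π := fun _ => Step S A B) t ω) *
        ∫ x, g x ∂G.nextKernel σ τ t (Preorder.frestrictLe (π := fun _ => Step S A B) t ω)
        ∂G.playMeasure σ τ s := by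
  have h := Kernel.map_frestrictLe_trajMeasure_compProd_eq_map_trajMeasure
    (X := fun _ => Step S A B) (μ₀ := (stageLaw σ τ [] s).toMeasure)
    (κ := G.nextKernel σ τ) (a := t)
  change (G.playMeasure σ τ s).map _ ⊗ₘ _ = (G.playMeasure σ τ s).map _ at h
  have h1 := integral_map (μ := G.playMeasure σ τ s)
    (φ := fun ω => (Preorder.frestrictLe (π := fun _ => Step S A B) t ω, ω (t + 1))) (by fun_prop)
    (f := fun z => c z.1 * g z.2) (Measurable.of_discrete.aestronglyMeasurable)
  rw [← h, Measure.integral_compProd .of_finite, integral_map (by fun_prop)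
    (Measurable.of_discrete.aestronglyMeasurable)] at h1
  rw [← h1]
  simp only [integral_const_mul]

theorem integrable_comp_frestrictLe (t : ℕ) (F : (∀ _ : Finset.Iic t, Step S A B) → ℝ) :
    Integrable (fun ω => F (Preorder.frestrictLe (π := fun _ => Step S A B) t ω))
      (G.playMeasure σ τ s) :=
  (Integrable.of_finite (f := F)).comp_measurable
    (μ := G.playMeasure σ τ s) (f := Preorder.frestrictLe (π := fun _ => Step S A B) t)
    (by fun_prop)

theorem integrable_discountWeight_mul (hΛ : ∀ s, 0 < Λ s) (hΛ' : ∀ s, Λ s ≤ 1)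
    (g : Step S A B → ℝ) (t k : ℕ) :
    Integrable (fun ω => discountWeight Λ t ω * g (ω k)) (G.playMeasure σ τ s) := by
  obtain ⟨M, hM⟩ := (Set.finite_range fun x => |g x|).bddAbove
  exact Integrable.of_bound ((measurable_discountWeight t).mul
    (Measurable.of_discrete.comp (measurable_pi_apply k))).aestronglyMeasurable _
    (ae_of_all _ fun ω => abs_discountWeight_mul_le hΛ' (fun s => (hΛ s).le)
      (fun x => hM ⟨x, rfl⟩) t ω k)

/-- The weight involves only stages before `t`, so the one-shot inequality, valid after every
history, can be integrated against it. -/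
theorem integral_discountWeight_le (hΛ' : ∀ s, Λ s ≤ 1) {w : S → ℝ} {Q : Step S A B → ℝ}
    (hw : ∀ h s, w s ≤ ∫ x, Q x ∂(stageLaw σ τ h s).toMeasure) (t : ℕ) :
    ∫ ω, discountWeight Λ t ω * w (ω t).state ∂G.playMeasure σ τ s ≤
      ∫ ω, discountWeight Λ t ω * Q (ω t) ∂G.playMeasure σ τ s := by
  rcases t with _ | t
  · simp only [discountWeight, Finset.range_zero, Finset.prod_empty, one_mul]
    rw [G.integral_playMeasure_zero σ τ s fun x => w x.state, integral_playMeasure_zero,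
      integral_stageLaw_state]
    exact hw _ _
  · simp only [discountWeight_succ_eq]
    rw [G.integral_playMeasure_succ σ τ s t
        (fun z => ∏ i : Finset.Iic t, (1 - Λ (z i).state)) fun x => w x.state,
      G.integral_playMeasure_succ σ τ s t (fun z => ∏ i : Finset.Iic t, (1 - Λ (z i).state)) Q]
    refine integral_mono (G.integrable_comp_frestrictLe σ τ s t fun z =>
      (∏ i : Finset.Iic t, (1 - Λ (z i).state)) * ∫ x, w x.state ∂G.nextKernel σ τ t z)
      (G.integrable_comp_frestrictLe σ τ s t fun z =>
      (∏ i : Finset.Iic t, (1 - Λ (z i).state)) * ∫ x, Q x ∂G.nextKernel σ τ t z) fun ω => ?_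
    refine mul_le_mul_of_nonneg_left ?_ (Finset.prod_nonneg fun _ _ => sub_nonneg.2 (hΛ' _))
    rw [integral_nextKernel, integral_nextKernel]
    refine Finset.sum_le_sum fun s' _ => mul_le_mul_of_nonneg_left ?_ ENNReal.toReal_nonneg
    rw [integral_stageLaw_state]
    exact hw _ s'

theorem integral_discountWeight_succ (g : S → ℝ) (t : ℕ) :
    ∫ ω, discountWeight Λ (t + 1) ω * g (ω (t + 1)).state ∂G.playMeasure σ τ s =
      ∫ ω, discountWeight Λ (t + 1) ω *
        ∑ s', (G.δ (ω t).state (ω t).act1 (ω t).act2 s').toReal * g s' ∂G.playMeasure σ τ s := by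
  simp only [discountWeight_succ_eq]
  rw [G.integral_playMeasure_succ σ τ s t
    (fun z => ∏ i : Finset.Iic t, (1 - Λ (z i).state)) fun x => g x.state]
  simp only [integral_nextKernel, integral_stageLaw_state]
  rfl

/-- If `w` satisfies the optimality inequality for Player 1 in all one-shot games, whatever the
past, then the expected discounted payoff is at least `w`. -/
theorem le_integral_discounted (hΛ : ∀ s, 0 < Λ s) (hΛ' : ∀ s, Λ s ≤ 1) {r : S → A → B → ℝ}
    {w : S → ℝ}
    (hw : ∀ h s, w s ≤ ∫ x, shapleyMatrix (fun s a b s' => (G.δ s a b s').toReal) r Λ w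
      x.state x.act1 x.act2 ∂(stageLaw σ τ h s).toMeasure) :
    w s ≤ ∫ ω, discounted r Λ ω ∂G.playMeasure σ τ s := by
  have : Nonempty S := ⟨s⟩
  obtain ⟨c, hc0, hc⟩ : ∃ c : ℝ, 0 < c ∧ ∀ s, c ≤ Λ s := by
    obtain ⟨s₀, hs₀⟩ := Finite.exists_min Λ
    exact ⟨Λ s₀, hΛ s₀, hs₀⟩
  have hc1 : c ≤ 1 := (hc s).trans (hΛ' s)
  set Q : Step S A B → ℝ := fun x => shapleyMatrix (fun s a b s' => (G.δ s a b s').toReal) r Λ w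
      x.state x.act1 x.act2
  let R : Step S A B → ℝ := fun x => Λ x.state * r x.state x.act1 x.act2
  let N : Step S A B → ℝ := fun x => (1 - Λ x.state) *
    ∑ s', (G.δ x.state x.act1 x.act2 s').toReal * w s'
  set P := G.playMeasure σ τ s
  have hint := fun g t k => G.integrable_discountWeight_mul σ τ s hΛ hΛ' g t k
  -- One-shot optimality at stage `t`, split into the reward at `t` and the continuation; the sum
  -- over stages telescopes in `hsum`.
  have hstep : ∀ t, ∫ ω, discountWeight Λ t ω * w (ω t).state ∂P ≤
      ∫ ω, discountWeight Λ t ω * R (ω t) ∂P +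
        ∫ ω, discountWeight Λ (t + 1) ω * w (ω (t + 1)).state ∂P := fun t => by
    refine (G.integral_discountWeight_le σ τ s hΛ' hw t).trans_eq ?_
    rw [G.integral_discountWeight_succ, ← integral_add (hint R t t)]
    · refine integral_congr_ae (ae_of_all _ fun ω => ?_)
      simp only [R, shapleyMatrix, discountWeight, Finset.prod_range_succ]
      ring
    · refine (hint N t t).congr (ae_of_all _ fun ω => ?_)
      simp only [N, discountWeight, Finset.prod_range_succ]
      ring
  have hsum : ∀ t, w s ≤ ∑ k ∈ Finset.range t, ∫ ω, discountWeight Λ k ω * R (ω k) ∂P +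
        ∫ ω, discountWeight Λ t ω * w (ω t).state ∂P := fun t => by
    induction t with
    | zero =>
      simp only [discountWeight, Finset.range_zero, Finset.prod_empty, one_mul, Finset.sum_empty,
        zero_add]
      rw [G.integral_playMeasure_zero σ τ s fun x => w x.state, integral_stageLaw_state]
    | succ t ih =>
      rw [Finset.sum_range_succ]
      linarith [hstep t]
  have hgeom : Summable fun t : ℕ => (1 - c) ^ t :=
    summable_geometric_of_lt_one (by linarith) (by linarith)
  obtain ⟨M, hM⟩ := (Set.finite_range fun x => |R x|).bddAbove
  obtain ⟨M', hM'⟩ := (Set.finite_range fun x : Step S A B => |w x.state|).bddAbove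
  have hR : HasSum (fun k => ∫ ω, discountWeight Λ k ω * R (ω k) ∂P)
      (∫ ω, discounted r Λ ω ∂P) := by
    have h := hasSum_integral_of_summable_integral_norm (μ := P)
      (F := fun k ω => discountWeight Λ k ω * R (ω k)) (fun k => hint R k k)
      (Summable.of_nonneg_of_le (fun k => integral_nonneg fun ω => norm_nonneg _)
        (fun k => ?_) (hgeom.mul_right M))
    · have hd : ∀ ω, discounted r Λ ω = ∑' k, discountWeight Λ k ω * R (ω k) := fun ω =>
        tsum_congr fun k => by simp only [R, discountWeight]; ring
      simpa only [hd] using h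
    · refine (integral_mono (hint R k k).norm (integrable_const ((1 - c) ^ k * M)) fun ω =>
        abs_discountWeight_mul_le hΛ' hc (fun x => hM ⟨x, rfl⟩) k ω k).trans_eq ?_
      simp
  -- The remainder after `t` stages decays geometrically because `Λ ≥ c > 0`.
  have hlim : Tendsto (fun t => ∫ ω, discountWeight Λ t ω * w (ω t).state ∂P) atTop (𝓝 0) := by
    refine squeeze_zero_norm (fun t => ?_) (by simpa using hgeom.tendsto_atTop_zero.mul_const M')
    refine (norm_integral_le_of_norm_le_const (ae_of_all _ fun ω =>
      abs_discountWeight_mul_le hΛ' hc (g := fun x => w x.state)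
        (fun x => hM' ⟨x, rfl⟩) t ω t)).trans_eq ?_
    simp
  have h := hR.tendsto_sum_nat.add hlim
  rw [add_zero] at h
  exact ge_of_tendsto' h hsum

/-- The lower bound applied to `-r` and `-w`. -/
theorem integral_discounted_le (hΛ : ∀ s, 0 < Λ s) (hΛ' : ∀ s, Λ s ≤ 1) {r : S → A → B → ℝ}
    {w : S → ℝ}
    (hw : ∀ h s, ∫ x, shapleyMatrix (fun s a b s' => (G.δ s a b s').toReal) r Λ w
      x.state x.act1 x.act2 ∂(stageLaw σ τ h s).toMeasure ≤ w s) :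
    ∫ ω, discounted r Λ ω ∂G.playMeasure σ τ s ≤ w s := by
  have h := G.le_integral_discounted σ τ s hΛ hΛ' (r := fun s a b => -r s a b)
    (w := fun s => -w s) fun h s => by
      have : ∀ x : Step S A B, shapleyMatrix (fun s a b s' => (G.δ s a b s').toReal)
          (fun s a b => -r s a b) Λ (fun s => -w s) x.state x.act1 x.act2 =
          -shapleyMatrix (fun s a b s' => (G.δ s a b s').toReal) r Λ w x.state x.act1 x.act2 := by
        intro x
        simp only [shapleyMatrix, mul_neg, Finset.sum_neg_distrib]
        ring
      simp only [this, integral_neg]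
      exact neg_le_neg (hw h s)
  have h2 : ∀ ω : ℕ → Step S A B, discounted (fun s a b => -r s a b) Λ ω = -discounted r Λ ω :=
    fun ω => by simp only [discounted, mul_neg, tsum_neg]
  simp only [h2, integral_neg] at h
  linarith

/-- The distribution on a finite type with given probabilities. -/
theorem exists_pmf_of_mem_stdSimplex {C : Type*} [Fintype C] {x : C → ℝ}
    (hx : x ∈ stdSimplex ℝ C) : ∃ q : PMF C, ∀ c, (q c).toReal = x c := by
  refine ⟨PMF.ofFintype (fun c => ENNReal.ofReal (x c)) ?_, fun c => ?_⟩
  · rw [← ENNReal.ofReal_sum_of_nonneg fun c _ => hx.1 c, hx.2, ENNReal.ofReal_one]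
  · rw [PMF.ofFintype_apply, ENNReal.toReal_ofReal (hx.1 c)]

theorem value_eq_of_isShapleySolution (hΛ : ∀ s, 0 < Λ s) (hΛ' : ∀ s, Λ s ≤ 1)
    {r : S → A → B → ℝ} {w : S → ℝ} {x : S → A → ℝ} {y : S → B → ℝ}
    (h : IsShapleySolution (fun s a b s' => (G.δ s a b s').toReal) r Λ w x y) :
    G.value r Λ s = w s := by
  choose x' hx' using fun s => exists_pmf_of_mem_stdSimplex (h.mem_left s)
  choose y' hy' using fun s => exists_pmf_of_mem_stdSimplex (h.mem_right s)
  have hlow : ∀ τ : Strategy S A B B, w s ≤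
      ∫ ω, discounted r Λ ω ∂G.playMeasure (fun _ s => x' s) τ s := fun τ => by
    refine G.le_integral_discounted _ _ s hΛ hΛ' fun l s => ?_
    rw [integral_stageLaw]
    simp only [hx', Finset.mul_sum, Step.state, Step.act1, Step.act2]
    rw [Finset.sum_comm]
    refine (le_sum_mul_of_mem_stdSimplex (τ l s).toReal_mem_stdSimplex (h.left s)).trans_eq ?_
    simp only [Finset.mul_sum]
    exact Finset.sum_congr rfl fun b _ => Finset.sum_congr rfl fun a _ => by ring
  have hup : ∀ σ : Strategy S A B A,
      ∫ ω, discounted r Λ ω ∂G.playMeasure σ (fun _ s => y' s) s ≤ w s := fun σ => by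
    refine G.integral_discounted_le _ _ s hΛ hΛ' fun l s => ?_
    rw [integral_stageLaw]
    simp only [hy', Step.state, Step.act1, Step.act2]
    exact sum_mul_le_of_mem_stdSimplex (σ l s).toReal_mem_stdSimplex (h.right s)
  have : Nonempty (Strategy S A B A) := ⟨fun _ s => x' s⟩
  have : Nonempty (Strategy S A B B) := ⟨fun _ s => y' s⟩
  -- A real infimum is only meaningful for a family bounded below; the constant `-M` satisfies the
  -- one-shot inequality against all strategies.
  have hbdd : ∀ σ : Strategy S A B A, BddBelow (Set.range fun τ : Strategy S A B B =>
      ∫ ω, discounted r Λ ω ∂G.playMeasure σ τ s) := fun σ => by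
    obtain ⟨M, hM⟩ := (Set.finite_range fun x : S × A × B => |r x.1 x.2.1 x.2.2|).bddAbove
    refine ⟨-M, ?_⟩
    rintro _ ⟨τ, rfl⟩
    refine G.le_integral_discounted σ τ s (w := fun _ => -M) hΛ hΛ' fun l s => ?_
    rw [integral_stageLaw]
    refine le_sum_mul_of_mem_stdSimplex (σ l s).toReal_mem_stdSimplex fun a =>
      le_sum_mul_of_mem_stdSimplex (τ l s).toReal_mem_stdSimplex fun b => ?_
    have h1 : -M ≤ r s a b := (abs_le.1 (hM ⟨(s, a, b), rfl⟩)).1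
    have h2 : ∑ s', (G.δ s a b s').toReal * -M = -M := by
      rw [← Finset.sum_mul, (G.δ s a b).toReal_mem_stdSimplex.2, one_mul]
    simp only [shapleyMatrix, Step.state, Step.act1, Step.act2, h2]
    nlinarith [mul_le_mul_of_nonneg_left h1 (hΛ s).le]
  have hle : ∀ σ : Strategy S A B A, (⨅ τ : Strategy S A B B,
      ∫ ω, discounted r Λ ω ∂G.playMeasure σ τ s) ≤ w s := fun σ =>
    (ciInf_le (hbdd σ) fun _ s => y' s).trans (hup σ)
  refine le_antisymm (ciSup_le hle) ?_
  exact (le_ciInf hlow).trans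
    (le_ciSup (f := fun σ : Strategy S A B A => ⨅ τ : Strategy S A B B,
      ∫ ω, discounted r Λ ω ∂G.playMeasure σ τ s)
      ⟨w s, by rintro _ ⟨σ, rfl⟩; exact hle σ⟩ fun _ s => x' s)
end CSG

/-! ### Cramer's rule and the matrix game on pure stationary strategies -/

/-- Some nonzero nonnegative combination of the rows of `W` is nonnegative. -/
def Matrix.HasNonnegCombination {I J : Type*} [Fintype I] (W : Matrix I J ℝ) : Prop :=
  ∃ x : I → ℝ, (∀ i, 0 ≤ x i) ∧ x ≠ 0 ∧ ∀ j, 0 ≤ ∑ i, x i * W i j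

section discountMatrix

variable {S : Type*} [Fintype S] [DecidableEq S]

/-- The matrix `1 - (1 - Λ) P`. -/
def discountMatrix (Λ : S → ℝ) (P : S → S → ℝ) : Matrix S S ℝ :=
  Matrix.of fun s s' => (if s = s' then 1 else 0) - (1 - Λ s) * P s s'

variable {Λ : S → ℝ} {P : S → S → ℝ}

theorem discountMatrix_mulVec (u : S → ℝ) (s : S) :
    (discountMatrix Λ P).mulVec u s = u s - (1 - Λ s) * ∑ s', P s s' * u s' := by
  simp [discountMatrix, Matrix.mulVec, dotProduct, sub_mul, Finset.mul_sum, mul_assoc]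

/-- Minimum principle: at a minimizer `s₀` of `u` the hypothesis leaves `0 ≤ Λ s₀ * u s₀`. -/
theorem nonneg_of_discountMatrix_mulVec_nonneg (hP : ∀ s, P s ∈ stdSimplex ℝ S)
    (hΛ : ∀ s, 0 < Λ s) (hΛ' : ∀ s, Λ s ≤ 1) {u : S → ℝ}
    (hu : ∀ s, 0 ≤ (discountMatrix Λ P).mulVec u s) (s : S) : 0 ≤ u s := by
  have : Nonempty S := ⟨s⟩
  obtain ⟨s₀, hs₀⟩ := Finite.exists_min u
  have h1 := mul_le_mul_of_nonneg_left (le_sum_mul_of_mem_stdSimplex (hP s₀) hs₀)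
    (sub_nonneg.2 (hΛ' s₀))
  have h2 := hu s₀
  rw [discountMatrix_mulVec] at h2
  have h3 : 0 ≤ Λ s₀ * u s₀ := by linarith
  exact (nonneg_of_mul_nonneg_right h3 (hΛ s₀)).trans (hs₀ s)

theorem det_discountMatrix_ne_zero (hP : ∀ s, P s ∈ stdSimplex ℝ S)
    (hΛ : ∀ s, 0 < Λ s) (hΛ' : ∀ s, Λ s ≤ 1) : (discountMatrix Λ P).det ≠ 0 := by
  intro h
  obtain ⟨v, hv, hv0⟩ := Matrix.exists_mulVec_eq_zero_iff.2 h
  refine hv (funext fun s => le_antisymm ?_ ?_)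
  · have := nonneg_of_discountMatrix_mulVec_nonneg hP hΛ hΛ' (u := -v)
      (fun s => by rw [Matrix.mulVec_neg, hv0]; simp) s
    simpa using this
  · exact nonneg_of_discountMatrix_mulVec_nonneg hP hΛ hΛ' (fun s => by rw [hv0]; simp) s

theorem det_discountMatrix_pos (hP : ∀ s, P s ∈ stdSimplex ℝ S)
    (hΛ : ∀ s, 0 < Λ s) (hΛ' : ∀ s, Λ s ≤ 1) : 0 < (discountMatrix Λ P).det := by
  -- Scaling `1 - Λ` by `t` deforms the identity (`t = 0`) into the given matrix (`t = 1`) through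
  -- nonsingular matrices, so the determinant keeps its sign.
  let f : ℝ → ℝ := fun t => (discountMatrix (fun s => 1 - t * (1 - Λ s)) P).det
  have hf : Continuous f := by
    refine Continuous.matrix_det (continuous_matrix fun s s' => ?_)
    simp only [discountMatrix, Matrix.of_apply]
    fun_prop
  have hf0 : f 0 = 1 := by
    simp only [f, discountMatrix, zero_mul, sub_zero, sub_self]
    convert Matrix.det_one (n := S) (R := ℝ)
    ext s s'
    simp [Matrix.one_apply]
  have hf1 : f 1 = (discountMatrix Λ P).det := by simp [f]
  rw [← hf1]
  by_contra! h
  obtain ⟨t, ht, ht0⟩ := intermediate_value_Icc' zero_le_one hf.continuousOn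
    (show (0 : ℝ) ∈ Set.Icc (f 1) (f 0) from ⟨h, by rw [hf0]; exact zero_le_one⟩)
  refine det_discountMatrix_ne_zero hP (fun s => ?_) (fun s => ?_) ht0
  · nlinarith [hΛ s, hΛ' s, ht.1, ht.2]
  · nlinarith [hΛ' s, ht.1]

/-- The numerator of Cramer's rule for the discounted payoff at `k`, minus `z` times its
denominator. -/
theorem mul_sub_le_det_updateCol (hP : ∀ s, P s ∈ stdSimplex ℝ S)
    (hΛ : ∀ s, 0 < Λ s) (hΛ' : ∀ s, Λ s ≤ 1) {u r : S → ℝ}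
    (hu : ∀ s, u s ≤ Λ s * r s + (1 - Λ s) * ∑ s', P s s' * u s') (z : ℝ) (k : S) :
    (discountMatrix Λ P).det * (u k - z) ≤
      ((discountMatrix Λ P).updateCol k fun s => Λ s * (r s - z)).det := by
  set D := (discountMatrix Λ P).det
  rw [← Matrix.cramer_apply]
  set c : S → ℝ := fun s => Λ s * (r s - z)
  have hD : 0 < D := det_discountMatrix_pos hP hΛ hΛ'
  -- The matrix sends this vector to `D` times the slack in `hu`: the constant `z` contributes `Λ z`
  -- on both sides and cancels.
  have h := nonneg_of_discountMatrix_mulVec_nonneg hP hΛ hΛ'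
    (u := (discountMatrix Λ P).cramer c - D • fun s => u s - z) (fun s => ?_) k
  · simpa using h
  · rw [Matrix.mulVec_sub, Matrix.mulVec_cramer, Matrix.mulVec_smul, Pi.sub_apply, Pi.smul_apply,
      Pi.smul_apply, discountMatrix_mulVec, smul_eq_mul, smul_eq_mul, ← mul_sub]
    refine mul_nonneg hD.le ?_
    have h1 : ∑ s', P s s' * (u s' - z) = ∑ s', P s s' * u s' - z := by
      simp only [mul_sub, Finset.sum_sub_distrib, ← Finset.sum_mul, (hP s).2, one_mul]
    rw [h1]
    have := hu s
    simp only [c]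
    linarith

theorem det_updateCol_le_mul_sub (hP : ∀ s, P s ∈ stdSimplex ℝ S)
    (hΛ : ∀ s, 0 < Λ s) (hΛ' : ∀ s, Λ s ≤ 1) {u r : S → ℝ}
    (hu : ∀ s, Λ s * r s + (1 - Λ s) * ∑ s', P s s' * u s' ≤ u s) (z : ℝ) (k : S) :
    ((discountMatrix Λ P).updateCol k fun s => Λ s * (r s - z)).det ≤
      (discountMatrix Λ P).det * (u k - z) := by
  have h := mul_sub_le_det_updateCol hP hΛ hΛ' (u := fun s => -u s) (r := fun s => -r s)
    (fun s => by simp only [mul_neg, Finset.sum_neg_distrib]; linarith [hu s]) (-z) k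
  have h2 : (fun s => Λ s * (-r s - -z)) = (-1 : ℝ) • fun s => Λ s * (r s - z) := by
    ext s; simp only [Pi.smul_apply, smul_eq_mul]; ring
  rw [h2, Matrix.det_updateCol_smul] at h
  linarith

end discountMatrix

/-- The determinant is multilinear in its rows and row `s` depends only on the action at `s`, so
averaging over a product distribution averages each row separately. -/
theorem sum_prod_mul_det {S C : Type*} [Fintype S] [DecidableEq S] [Fintype C]
    (x : S → C → ℝ) (ρ : S → C → S → ℝ) :
    ∑ i : S → C, (∏ s, x s (i s)) * (Matrix.of fun s => ρ s (i s)).det =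
      (Matrix.of fun s s' => ∑ c, x s c * ρ s c s').det := by
  have h := (Matrix.detRowAlternating (n := S) (R := ℝ)).toMultilinearMap.map_sum
    fun s c => x s c • ρ s c
  have h2 : (Matrix.of fun s s' => ∑ c, x s c * ρ s c s') = fun s => ∑ c, x s c • ρ s c := by
    ext s s'; simp
  rw [h2]
  refine Eq.trans ?_ h.symm
  refine Finset.sum_congr rfl fun i _ => ?_
  exact ((Matrix.detRowAlternating (n := S) (R := ℝ)).toMultilinearMap.map_smul_univ
    (fun s => x s (i s)) fun s => ρ s (i s)).symm

theorem sum_prod_eq_one {S C : Type*} [Fintype S] [DecidableEq S] [Fintype C] {x : S → C → ℝ}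
    (hx : ∀ s, x s ∈ stdSimplex ℝ C) : ∑ i : S → C, ∏ s, x s (i s) = 1 := by
  rw [← Fintype.piFinset_univ, ← Finset.prod_univ_sum]
  simp [(hx _).2]

theorem sum_mem_stdSimplex {S C : Type*} [Fintype S] [Fintype C] {x : C → ℝ} (hx : x ∈ stdSimplex ℝ C)
    {q : C → S → ℝ} (hq : ∀ c, q c ∈ stdSimplex ℝ S) :
    (fun s' => ∑ c, x c * q c s') ∈ stdSimplex ℝ S := by
  refine ⟨fun s' => Finset.sum_nonneg fun c _ => mul_nonneg (hx.1 c) ((hq c).1 s'), ?_⟩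
  rw [Finset.sum_comm]
  simp only [← Finset.mul_sum, (hq _).2, mul_one, hx.2]

theorem sum_mul_shapley {S C : Type*} [Fintype S] [Fintype C] (x : C → ℝ) (q : C → S → ℝ) (ρ : C → ℝ)
    (l : ℝ) (w : S → ℝ) :
    ∑ c, x c * (l * ρ c + (1 - l) * ∑ s', q c s' * w s') =
      l * ∑ c, x c * ρ c + (1 - l) * ∑ s', (∑ c, x c * q c s') * w s' := by
  simp only [mul_add, Finset.sum_add_distrib, Finset.mul_sum, Finset.sum_mul]
  rw [Finset.sum_comm (γ := S)]
  congr 1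
  · exact Finset.sum_congr rfl fun _ _ => by ring
  · exact Finset.sum_congr rfl fun _ _ => Finset.sum_congr rfl fun _ _ => by ring

section gameMatrix

variable {S A B : Type*} [Fintype S] [DecidableEq S] [Fintype A] [Fintype B]

/-- The matrix indexed by the pairs of pure stationary strategies whose matrix game has a
nonnegative value if and only if the discounted game starting at `k` has value at least `z`. -/
def gameMatrix (p : S → A → B → S → ℝ) (r : S → A → B → ℝ) (Λ : S → ℝ) (k : S) (z : ℝ) :
    Matrix (S → A) (S → B) ℝ :=
  Matrix.of fun i j => ((discountMatrix Λ fun s => p s (i s) (j s)).updateCol k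
    fun s => Λ s * (r s (i s) (j s) - z)).det

/-- The action-independent parts of the entries survive the averaging because the weights at each
state sum to one. -/
theorem sum_prod_mul_det_updateCol {C : Type*} [Fintype C] {x : S → C → ℝ}
    (hx : ∀ s, x s ∈ stdSimplex ℝ C) (Λ : S → ℝ) (p : S → C → S → ℝ) (r : S → C → ℝ) (k : S)
    (z : ℝ) :
    ∑ i : S → C, (∏ s, x s (i s)) * ((discountMatrix Λ fun s => p s (i s)).updateCol k
        fun s => Λ s * (r s (i s) - z)).det =
      ((discountMatrix Λ fun s s' => ∑ c, x s c * p s c s').updateCol k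
        fun s => Λ s * (∑ c, x s c * r s c - z)).det := by
  have h := sum_prod_mul_det x fun s c s' => if s' = k then Λ s * (r s c - z) else
    (if s = s' then 1 else 0) - (1 - Λ s) * p s c s'
  convert h using 3
  · congr 1
    ext s s'
    simp [discountMatrix, Matrix.updateCol_apply]
  · ext s s'
    simp only [discountMatrix, Matrix.updateCol_apply, Matrix.of_apply]
    split_ifs <;> simp only [mul_sub, Finset.sum_sub_distrib, ← Finset.sum_mul, (hx s).2, one_mul,
      Finset.mul_sum, mul_zero, Finset.sum_const_zero, mul_one, mul_left_comm]

/-- The product of the optimal mixed actions `x` is the required combination when `z ≤ w k`. If `w k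
< z`, the product of the `y s` makes every row strictly negative, which excludes any nonnegative
combination. -/
theorem IsShapleySolution.le_iff {p : S → A → B → S → ℝ} (hp : ∀ s a b, p s a b ∈ stdSimplex ℝ S)
    {r : S → A → B → ℝ} {Λ : S → ℝ} (hΛ : ∀ s, 0 < Λ s) (hΛ' : ∀ s, Λ s ≤ 1)
    {w : S → ℝ} {x : S → A → ℝ} {y : S → B → ℝ} (h : IsShapleySolution p r Λ w x y)
    (k : S) (z : ℝ) : z ≤ w k ↔ (gameMatrix p r Λ k z).HasNonnegCombination := by
  constructor
  · intro hz
    refine ⟨fun i => ∏ s, x s (i s), fun i => Finset.prod_nonneg fun s _ => (h.mem_left s).1 _,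
      fun h0 => ?_, fun j => ?_⟩
    · have := sum_prod_eq_one h.mem_left
      simp only [funext_iff, Pi.zero_apply] at h0
      simp [h0] at this
    · have hP := fun s => sum_mem_stdSimplex (h.mem_left s) fun a => hp s a (j s)
      refine le_of_le_of_eq ?_ (sum_prod_mul_det_updateCol h.mem_left Λ
        (fun s a => p s a (j s)) (fun s a => r s a (j s)) k z).symm
      refine (mul_nonneg (det_discountMatrix_pos hP hΛ hΛ').le (sub_nonneg.2 hz)).trans
        (mul_sub_le_det_updateCol hP hΛ hΛ' (fun s => ?_) z k)
      exact (h.left s (j s)).trans_eq (sum_mul_shapley _ _ _ _ _)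
  · rintro ⟨ξ, hξ, hξ0, hξW⟩
    by_contra! hz
    have hneg : ∀ i, ∑ j : S → B, (∏ s, y s (j s)) * gameMatrix p r Λ k z i j < 0 := fun i => by
      have hP := fun s => sum_mem_stdSimplex (h.mem_right s) fun b => hp s (i s) b
      refine lt_of_eq_of_lt (sum_prod_mul_det_updateCol h.mem_right Λ
        (fun s b => p s (i s) b) (fun s b => r s (i s) b) k z) ?_
      refine (det_updateCol_le_mul_sub hP hΛ hΛ' (fun s => ?_) z k).trans_lt
        (mul_neg_of_pos_of_neg (det_discountMatrix_pos hP hΛ hΛ') (sub_neg.2 hz))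
      exact (sum_mul_shapley _ _ _ _ _).symm.trans_le (h.right s (i s))
    obtain ⟨i₀, hi₀⟩ := Function.ne_iff.1 hξ0
    have h1 : 0 ≤ ∑ j : S → B, (∏ s, y s (j s)) * ∑ i, ξ i * gameMatrix p r Λ k z i j :=
      Finset.sum_nonneg fun j _ => mul_nonneg
        (Finset.prod_nonneg fun s _ => (h.mem_right s).1 _) (hξW j)
    have h2 : ∑ j : S → B, (∏ s, y s (j s)) * ∑ i, ξ i * gameMatrix p r Λ k z i j =
        ∑ i, ξ i * ∑ j : S → B, (∏ s, y s (j s)) * gameMatrix p r Λ k z i j := by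
      simp only [Finset.mul_sum]
      rw [Finset.sum_comm]
      exact Finset.sum_congr rfl fun _ _ => Finset.sum_congr rfl fun _ _ => by ring
    have h3 : ∑ i, ξ i * ∑ j : S → B, (∏ s, y s (j s)) * gameMatrix p r Λ k z i j < 0 :=
      Finset.sum_neg' (fun i _ => mul_nonpos_of_nonneg_of_nonpos (hξ i) (hneg i).le)
        ⟨i₀, Finset.mem_univ _, mul_neg_of_pos_of_neg ((hξ i₀).lt_of_ne' hi₀) (hneg i₀)⟩
    linarith

end gameMatrix

/-! ### Extreme rays and sign patterns of minors -/

/-- Extreme rays of a polyhedral cone: a nonzero point `x` of the cone `{x | ∀ c, 0 ≤ ℓ c x}` with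
as few slack constraints as possible is determined, up to a factor, by its tight constraints. -/
theorem exists_eq_smul_of_tight {C V : Type*} [Fintype C] [AddCommGroup V] [Module ℝ V]
    (l : C → V →ₗ[ℝ] ℝ) (hinj : ∀ u, (∀ c, l c u = 0) → u = 0) {x : V} (hx : ∀ c, 0 ≤ l c x)
    (hx0 : x ≠ 0)
    (hmin : ∀ x', (∀ c, 0 ≤ l c x') → x' ≠ 0 → ¬ {c | l c x' ≠ 0} ⊂ {c | l c x ≠ 0})
    {u : V} (hu : ∀ c, l c x = 0 → l c u = 0) : ∃ t : ℝ, u = t • x := by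
  classical
  by_contra! hne
  have hu0 : u ≠ 0 := fun h => hne 0 (by rw [h, zero_smul])
  -- Up to replacing `u` by `-u`, some constraint decreases along the direction.
  obtain ⟨v, hv, hvne, c₀, hc₀⟩ : ∃ v, (∀ c, l c x = 0 → l c v = 0) ∧ (∀ t : ℝ, v ≠ t • x) ∧
      ∃ c, l c v < 0 := by
    obtain ⟨c, hc⟩ : ∃ c, l c u ≠ 0 := by
      by_contra! h
      exact hu0 (hinj u h)
    rcases lt_or_gt_of_ne hc with h | h
    · exact ⟨u, hu, hne, c, h⟩
    · refine ⟨-u, fun c hc => by rw [map_neg, hu c hc, neg_zero], fun t ht => hne (-t) ?_, c, ?_⟩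
      · rw [neg_smul, ← ht, neg_neg]
      · rw [map_neg]; exact neg_neg_of_pos h
  -- Ratio test: `c₁` is the first constraint to become tight when moving from `x` along `v`. The
  -- point reached has strictly fewer slack constraints, against minimality.
  obtain ⟨c₁, hc₁, hmin₁⟩ := (Finset.univ.filter fun c => l c v < 0).exists_min_image
    (fun c => l c x / (-l c v)) ⟨c₀, by simpa using hc₀⟩
  simp only [Finset.mem_filter, Finset.mem_univ, true_and] at hc₁ hmin₁
  set t := l c₁ x / (-l c₁ v) with ht
  have ht0 : 0 ≤ t := div_nonneg (hx _) (by linarith)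
  have htight : l c₁ (x + t • v) = 0 := by
    rw [map_add, map_smul, smul_eq_mul, ht, div_neg, neg_mul, div_mul_cancel₀ _ hc₁.ne,
      add_neg_cancel]
  refine hmin (x + t • v) (fun c => ?_) (fun h => ?_) ⟨fun c hc hc' => hc ?_, fun h => ?_⟩
  · rw [map_add, map_smul, smul_eq_mul]
    rcases lt_or_ge (l c v) 0 with h | h
    · have := hmin₁ c h
      rw [le_div_iff₀ (by linarith)] at this
      linarith
    · have := mul_nonneg ht0 h
      linarith [hx c]
  · have ht1 : t ≠ 0 := by
      rintro h0
      rw [h0, zero_smul, add_zero] at h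
      exact hx0 h
    refine hvne (-t⁻¹) ?_
    have : x = -(t • v) := eq_neg_of_add_eq_zero_left h
    rw [this, smul_neg, neg_smul, neg_neg, inv_smul_smul₀ ht1]
  · rw [map_add, map_smul, hc', hv c hc', smul_zero, add_zero]
  · exact h (a := c₁) (fun h0 => hc₁.ne (hv c₁ h0)) htight

/-- A trivial annihilator means that `x` and the `c j` span. Extending `{x}` to a basis taken from
this family uses exactly `m` of the `c j`. -/
theorem exists_subfamily_trivial_annihilator {m : ℕ} {J : Type*} [Finite J]
    (x : Fin (m + 1) → ℝ) (hx : x ≠ 0) (c : J → Fin (m + 1) → ℝ)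
    (h : ∀ v : Fin (m + 1) → ℝ, v ⬝ᵥ x = 0 → (∀ j, v ⬝ᵥ c j = 0) → v = 0) :
    ∃ f : Fin m → J, ∀ v : Fin (m + 1) → ℝ, v ⬝ᵥ x = 0 → (∀ q, v ⬝ᵥ c (f q) = 0) → v = 0 := by
  classical
  let w : Option J → Fin (m + 1) → ℝ := fun o => o.elim x c
  obtain ⟨b, -, hxb, hsb, hb⟩ := exists_linearIndepOn_extension (K := ℝ) (v := w)
    (s := {none}) (t := Set.univ) ((linearIndepOn_singleton_iff ℝ).2 hx) (Set.subset_univ _)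
  have := Fintype.ofFinite {j // some j ∈ b}
  let g : Option {j // some j ∈ b} → b := fun o =>
    o.elim ⟨none, hxb rfl⟩ fun j => ⟨some j.1, j.2⟩
  have hg : Function.Injective g := by
    rintro (_ | i) (_ | j) hij <;> simp_all [g, Subtype.ext_iff]
  have hli : LinearIndependent ℝ fun o => w (g o) := hb.comp g hg
  have hgs : ∀ o : b, ∃ o', g o' = o := by
    rintro ⟨_ | j, hj⟩
    · exact ⟨none, rfl⟩
    · exact ⟨some ⟨j, hj⟩, rfl⟩
  have hinj : ∀ v : Fin (m + 1) → ℝ, (∀ o, v ⬝ᵥ w (g o) = 0) → v = 0 := fun v hv => by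
    have hspan : ∀ β ∈ Submodule.span ℝ (w '' b), v ⬝ᵥ β = 0 := fun β hβ => by
      induction hβ using Submodule.span_induction with
      | mem β hβ =>
        obtain ⟨o, ho, rfl⟩ := hβ
        obtain ⟨o', ho'⟩ := hgs ⟨o, ho⟩
        have := hv o'
        rwa [ho'] at this
      | zero => exact dotProduct_zero v
      | add β γ _ _ h1 h2 => rw [dotProduct_add, h1, h2, add_zero]
      | smul t β _ h1 => rw [dotProduct_smul, h1, smul_zero]
    exact h v (hspan _ (hsb ⟨none, trivial, rfl⟩)) fun j => hspan _ (hsb ⟨some j, trivial, rfl⟩)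
  have hle : Fintype.card (Option {j // some j ∈ b}) ≤ m + 1 := by
    simpa using hli.fintype_card_le_finrank
  have hge : m + 1 ≤ Fintype.card (Option {j // some j ∈ b}) := by
    let F : (Fin (m + 1) → ℝ) →ₗ[ℝ] (Option {j // some j ∈ b} → ℝ) :=
      LinearMap.pi fun o => dotProductBilin ℝ ℝ |>.flip (w (g o))
    have hF : Function.Injective F := by
      rw [injective_iff_map_eq_zero]
      exact fun v hv => hinj v fun o => congrFun hv o
    simpa using LinearMap.finrank_le_finrank_of_injective hF
  have hcard : Fintype.card {j // some j ∈ b} = m := by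
    rw [Fintype.card_option] at hle hge
    omega
  let e := (Fintype.equivFinOfCardEq hcard).symm
  refine ⟨fun q => (e q).1, fun v hv1 hv2 => hinj v ?_⟩
  rintro (_ | j)
  · exact hv1
  · have := hv2 (e.symm j)
    change v ⬝ᵥ c j.1 = 0
    simpa using this

/-- Laplace expansion: pairing the vector of signed cofactors with column `j` gives a minor again,
so all the certificate's conditions concern minors. -/
theorem Matrix.det_submatrix_cons {I J : Type*} (W : Matrix I J ℝ) {m : ℕ} (e : Fin (m + 1) → I)
    (f : Fin m → J) (j : J) :
    (W.submatrix e (Fin.cons j f)).det = ∑ i : Fin (m + 1), (-1) ^ (i : ℕ) *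
      (W.submatrix (e ∘ i.succAbove) f).det * W (e i) j := by
  rw [Matrix.det_succ_column_zero]
  refine Finset.sum_congr rfl fun i _ => ?_
  have : (W.submatrix e (Fin.cons j f)).submatrix i.succAbove Fin.succ =
      W.submatrix (e ∘ i.succAbove) f := by
    ext a b
    simp
  rw [this, Matrix.submatrix_apply, Fin.cons_zero]
  ring

/-- A certificate for `HasNonnegCombination` in terms of the signs of minors. -/
def Matrix.HasMinorCertificate {I J : Type*} (W : Matrix I J ℝ) (m : ℕ) (e : Fin (m + 1) ↪ I)
    (f : Fin m → J) (s : ℝ) : Prop :=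
  (∀ i : Fin (m + 1), 0 ≤ s * ((-1) ^ (i : ℕ) * (W.submatrix (e ∘ i.succAbove) f).det)) ∧
    (∃ i : Fin (m + 1), (W.submatrix (e ∘ i.succAbove) f).det ≠ 0) ∧
    ∀ j, 0 ≤ s * (W.submatrix e (Fin.cons j f)).det

/-- The signed cofactors, extended by zero off the rows `e`, are the combination. -/
theorem Matrix.HasMinorCertificate.hasNonnegCombination {I J : Type*} [Fintype I]
    {W : Matrix I J ℝ} {m : ℕ} {e : Fin (m + 1) ↪ I} {f : Fin m → J} {s : ℝ} (hs : s ≠ 0)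
    (h : W.HasMinorCertificate m e f s) : W.HasNonnegCombination := by
  classical
  obtain ⟨h1, ⟨i₀, hi₀⟩, h3⟩ := h
  set y : Fin (m + 1) → ℝ := fun i => s * ((-1) ^ (i : ℕ) *
    (W.submatrix (e ∘ i.succAbove) f).det) with hy
  have hsum : ∀ a, ∑ i, (if e i = a then y i else 0) = Function.extend e y 0 a := fun a => by
    by_cases ha : ∃ i, e i = a
    · obtain ⟨i, rfl⟩ := ha
      simp [e.injective.extend_apply]
    · rw [Function.extend_apply' _ _ _ ha]
      exact Finset.sum_eq_zero fun i _ => if_neg fun hi => ha ⟨i, hi⟩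
  refine ⟨Function.extend e y 0, fun a => ?_, fun h0 => ?_, fun j => ?_⟩
  · rw [← hsum]
    exact Finset.sum_nonneg fun i _ => ite_nonneg (h1 i) le_rfl
  · have := congrFun h0 (e i₀)
    rw [e.injective.extend_apply] at this
    simp [hy, hs, hi₀] at this
  · simp only [← hsum, Finset.sum_mul]
    rw [Finset.sum_comm]
    refine (h3 j).trans_eq ?_
    rw [Matrix.det_submatrix_cons, Finset.mul_sum]
    refine Finset.sum_congr rfl fun i _ => ?_
    simp [hy]
    ring

/-- Take a point `x` of the cone with fewest slack constraints and let `e` list its support. On the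
support `x` is determined up to scale by its tight columns, `m` of which suffice; their cofactor
vector is orthogonal to the same columns, hence proportional to `x`. -/
theorem Matrix.HasNonnegCombination.exists_minorCertificate {I J : Type*} [Fintype I] [Fintype J]
    {W : Matrix I J ℝ} (h : W.HasNonnegCombination) :
    ∃ (m : ℕ) (e : Fin (m + 1) ↪ I) (f : Fin m → J) (s : ℝ), (s = 1 ∨ s = -1) ∧
      W.HasMinorCertificate m e f s := by
  classical
  let l : I ⊕ J → (I → ℝ) →ₗ[ℝ] ℝ := Sum.elim LinearMap.proj
    fun j => dotProductBilin ℝ ℝ |>.flip fun i => W i j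
  have hl1 : ∀ i x, l (Sum.inl i) x = x i := fun _ _ => rfl
  have hl2 : ∀ j x, l (Sum.inr j) x = ∑ i, x i * W i j := fun _ _ => rfl
  obtain ⟨x, ⟨hx, hx0⟩, hmin⟩ : ∃ x : I → ℝ, ((∀ c, 0 ≤ l c x) ∧ x ≠ 0) ∧
      ∀ x', (∀ c, 0 ≤ l c x') → x' ≠ 0 → ¬ {c | l c x' ≠ 0} ⊂ {c | l c x ≠ 0} := by
    obtain ⟨x₀, h1, h2, h3⟩ := h
    obtain ⟨x, hx, hmin⟩ := WellFounded.has_min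
      (measure fun x : I → ℝ => {c | l c x ≠ 0}.ncard).wf {x | (∀ c, 0 ≤ l c x) ∧ x ≠ 0}
      ⟨x₀, by rintro (i | j); exacts [h1 i, h3 j], h2⟩
    exact ⟨x, hx, fun x' h1 h2 h3 => hmin x' ⟨h1, h2⟩ (Set.ncard_lt_ncard h3 (Set.toFinite _))⟩
  have hkey := fun u => exists_eq_smul_of_tight l (fun u hu => funext fun i => hu (Sum.inl i)) hx
    hx0 hmin (u := u)
  obtain ⟨i₀, hi₀⟩ := Function.ne_iff.1 hx0
  obtain ⟨m, hm⟩ : ∃ m, Fintype.card {i // x i ≠ 0} = m + 1 :=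
    have : Nonempty {i // x i ≠ 0} := ⟨⟨i₀, hi₀⟩⟩
    Nat.exists_eq_succ_of_ne_zero Fintype.card_ne_zero
  let ε := (Fintype.equivFinOfCardEq hm).symm
  let e : Fin (m + 1) ↪ I := ε.toEmbedding.trans (Function.Embedding.subtype _)
  have he : ∀ i, x i ≠ 0 → ∃ a, e a = i := fun i hi => ⟨ε.symm ⟨i, hi⟩, by simp [e]⟩
  have hsum : ∀ g : I → ℝ, (∀ i, x i = 0 → g i = 0) → ∑ a, g (e a) = ∑ i, g i := fun g hg => by
    rw [← Finset.sum_map Finset.univ e g]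
    refine Finset.sum_subset (Finset.subset_univ _) fun i _ hi => hg i ?_
    by_contra hne
    obtain ⟨a, rfl⟩ := he i hne
    exact hi (Finset.mem_map_of_mem e (Finset.mem_univ a))
  have hker : ∀ v : Fin (m + 1) → ℝ,
      (∀ j : {j // ∑ i, x i * W i j = 0}, v ⬝ᵥ (fun a => W (e a) j) = 0) →
      ∃ t : ℝ, v = t • (x ∘ e) := fun v hv => by
    have hv0 : ∀ i, x i = 0 → Function.extend e v 0 i = 0 := fun i hi =>
      Function.extend_apply' _ _ _ (by rintro ⟨a, rfl⟩; exact (ε a).2 hi)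
    obtain ⟨t, ht⟩ := hkey (Function.extend e v 0) (by
      rintro (i | j) hc
      · exact hv0 i hc
      · rw [hl2, ← hsum _ fun i hi => by rw [hv0 i hi, zero_mul]]
        simpa only [e.injective.extend_apply, dotProduct] using hv ⟨j, hc⟩)
    refine ⟨t, funext fun a => ?_⟩
    rw [← e.injective.extend_apply v 0 a, ht]
    rfl
  have hxe : x ∘ e ≠ 0 := fun h0 => by
    obtain ⟨a, rfl⟩ := he i₀ hi₀
    exact hi₀ (congrFun h0 a)
  have hxx : (x ∘ e) ⬝ᵥ (x ∘ e) ≠ 0 := fun h0 => hxe (dotProduct_self_eq_zero.1 h0)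
  obtain ⟨f, hf⟩ := exists_subfamily_trivial_annihilator (x ∘ e) hxe
    (fun (j : {j // ∑ i, x i * W i j = 0}) a => W (e a) j) fun v hv1 hv2 => by
      obtain ⟨t, rfl⟩ := hker v hv2
      rw [smul_dotProduct, smul_eq_mul, mul_eq_zero] at hv1
      rw [hv1.resolve_right hxx, zero_smul]
  set y : Fin (m + 1) → ℝ := fun i =>
    (-1) ^ (i : ℕ) * (W.submatrix (e ∘ i.succAbove) fun q => (f q).1).det with hy
  have hdet : ∀ j, (W.submatrix e (Fin.cons j fun q => (f q).1)).det = y ⬝ᵥ fun a => W (e a) j :=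
    W.det_submatrix_cons e _
  have hyf : ∀ q, (y ⬝ᵥ fun a => W (e a) (f q)) = 0 := fun q => by
    rw [← hdet]
    exact Matrix.det_zero_of_column_eq (Fin.succ_ne_zero q).symm fun a => by simp
  -- This pairing is the determinant with columns `x` and the chosen ones, nonzero since only `0`
  -- annihilates them all.
  have hyx : y ⬝ᵥ (x ∘ e) ≠ 0 := by
    let W' : Matrix I (Option J) ℝ := Matrix.of fun i o => o.elim (x i) (W i)
    have hW' : (W'.submatrix e (Fin.cons none fun q => some (f q).1)).det = y ⬝ᵥ (x ∘ e) :=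
      W'.det_submatrix_cons e _ _
    rw [← hW']
    intro h0
    obtain ⟨v, hv, hv0⟩ := Matrix.exists_vecMul_eq_zero_iff.2 h0
    exact hv (hf v (congrFun hv0 0) fun q => congrFun hv0 q.succ)
  -- The projection coefficient: `y - t • x` annihilates `x` and all the chosen columns, so it
  -- vanishes.
  set t := (y ⬝ᵥ (x ∘ e)) / ((x ∘ e) ⬝ᵥ (x ∘ e))
  have hyt : y = t • (x ∘ e) := by
    rw [← sub_eq_zero]
    refine hf _ ?_ fun q => ?_
    · rw [sub_dotProduct, smul_dotProduct, smul_eq_mul, div_mul_cancel₀ _ hxx, sub_self]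
    · rw [sub_dotProduct, hyf, smul_dotProduct]
      have h0 : ((x ∘ e) ⬝ᵥ fun a => W (e a) (f q)) = 0 :=
        (hsum (fun i => x i * W i (f q)) fun i hi => by rw [hi, zero_mul]).trans (f q).2
      rw [h0, smul_zero, sub_zero]
  obtain ⟨s, hs, hst⟩ : ∃ s : ℝ, (s = 1 ∨ s = -1) ∧ 0 ≤ s * t := by
    rcases le_total 0 t with h | h
    · exact ⟨1, Or.inl rfl, by linarith⟩
    · exact ⟨-1, Or.inr rfl, by linarith⟩
  refine ⟨m, e, fun q => (f q).1, s, hs, fun i => ?_, ?_, fun j => ?_⟩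
  · change 0 ≤ s * y i
    rw [hyt, Pi.smul_apply, smul_eq_mul, ← mul_assoc]
    exact mul_nonneg hst (hx (Sum.inl _))
  · by_contra! h0
    exact hyx (by simp [hy, h0, dotProduct])
  · rw [hdet, hyt, smul_dotProduct, smul_eq_mul, ← mul_assoc]
    refine mul_nonneg hst ((hx (Sum.inr j)).trans_eq ?_)
    exact (hsum (fun i => x i * W i j) fun i hi => by rw [hi, zero_mul]).symm

/-- Two matrices whose minors of order at most the number of rows have the same signs have
nonnegative combinations of the rows at the same time. -/
theorem Matrix.HasNonnegCombination.of_sign_minors_eq {I J : Type*} [Fintype I] [Fintype J]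
    {W W' : Matrix I J ℝ} (h : W.HasNonnegCombination)
    (hsign : ∀ m ≤ Fintype.card I, ∀ (e : Fin m → I) (f : Fin m → J),
      SignType.sign (W.submatrix e f).det = SignType.sign (W'.submatrix e f).det) :
    W'.HasNonnegCombination := by
  obtain ⟨m, e, f, s, hs, h1, ⟨i₀, h2⟩, h3⟩ := h.exists_minorCertificate
  have hm : m + 1 ≤ Fintype.card I := by simpa using Fintype.card_le_of_embedding e
  have hs0 : s ≠ 0 := by rcases hs with rfl | rfl <;> norm_num
  refine Matrix.HasMinorCertificate.hasNonnegCombination hs0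
    (e := e) (f := f) ⟨fun i => ?_, ⟨i₀, ?_⟩, fun j => ?_⟩
  · rw [← sign_nonneg_iff, sign_mul, sign_mul, ← hsign _ (by omega), ← sign_mul, ← sign_mul,
      sign_nonneg_iff]
    exact h1 i
  · rwa [← sign_ne_zero, ← hsign _ (by omega), sign_ne_zero]
  · rw [← sign_nonneg_iff, sign_mul, ← hsign _ hm, ← sign_mul, sign_nonneg_iff]
    exact h3 j

/-! ### Constant signs of polynomials on rapidly decreasing points -/

section smallRegion

/-- The points of `(0, 1]^d` each of whose coordinates is at most `x` times the `K`-th powers of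
the previous coordinates. -/
def smallRegion (K : ℕ) (x : ℝ) (d : ℕ) : Set (Fin d → ℝ) :=
  {lam | ∀ i, 0 < lam i ∧ lam i ≤ 1 ∧ lam i ≤ x * ∏ j, if j < i then lam j ^ K else 1}

theorem smallRegion_subset_Ioc {K : ℕ} {x : ℝ} {d : ℕ} {lam : Fin d → ℝ}
    (h : lam ∈ smallRegion K x d) (i : Fin d) : lam i ∈ Set.Ioc (0 : ℝ) 1 :=
  ⟨(h i).1, (h i).2.1⟩

theorem cons_mem_smallRegion {K : ℕ} {x t : ℝ} {d : ℕ} {lam : Fin d → ℝ} (ht : 0 < t) (ht1 : t ≤ 1)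
    (htx : t ≤ x) (h : lam ∈ smallRegion K (x * t ^ K) d) :
    Fin.cons t lam ∈ smallRegion K x (d + 1) := by
  refine Fin.cases ?_ fun i => ?_
  · simpa using ⟨ht, ht1, htx⟩
  · simpa [Fin.prod_univ_succ, mul_assoc] using h i

/-- The last coordinate where the exponents differ decides. One extra factor `lam i` is at most `x *
H`, and `H` outweighs any excess of `α` over `β` in the earlier coordinates, as exponents there are
at most `K`. -/
theorem prod_pow_le_of_lt {K : ℕ} {x : ℝ} {d : ℕ} {α β : Fin d → ℕ} (hα : ∀ i, α i ≤ K)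
    {i : Fin d} (hi : α i < β i) (hgt : ∀ j, i < j → α j = β j) {lam : Fin d → ℝ}
    (hlam : lam ∈ smallRegion K x d) : ∏ j, lam j ^ β j ≤ x * ∏ j, lam j ^ α j := by
  set H := ∏ j, if j < i then lam j ^ K else 1
  have hH : 0 < H := Finset.prod_pos fun j _ => by
    split_ifs
    exacts [pow_pos (hlam j).1 _, one_pos]
  have h1 : (∏ j, lam j ^ β j) * H ≤ (∏ j, lam j ^ α j) * lam i := by
    have hi' : lam i = ∏ j, if j = i then lam j else 1 := by simp
    rw [hi', ← Finset.prod_mul_distrib, ← Finset.prod_mul_distrib]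
    refine Finset.prod_le_prod (fun j _ => ?_) fun j _ => ?_
    · exact mul_nonneg (pow_pos (hlam j).1 _).le
        (by split_ifs; exacts [(pow_pos (hlam j).1 _).le, zero_le_one])
    · obtain ⟨h0, h1, -⟩ := hlam j
      rcases lt_trichotomy j i with hj | rfl | hj
      · rw [if_pos hj, if_neg hj.ne, mul_one, ← pow_add]
        exact pow_le_pow_of_le_one h0.le h1 ((hα j).trans (Nat.le_add_left _ _))
      · rw [if_neg (lt_irrefl _), if_pos rfl, mul_one, ← pow_succ]
        exact pow_le_pow_of_le_one h0.le h1 hi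
      · rw [if_neg hj.not_gt, if_neg hj.ne', hgt j hj]
  have h2 : (∏ j, lam j ^ α j) * lam i ≤ (∏ j, lam j ^ α j) * (x * H) :=
    mul_le_mul_of_nonneg_left (hlam i).2.2 (Finset.prod_nonneg fun j _ => (pow_pos (hlam j).1 _).le)
  refine le_of_mul_le_mul_right (h1.trans (h2.trans_eq ?_)) hH
  ring

/-- On a small region, distinct monomials of bounded degree are of different orders of magnitude,
in an order that does not depend on the point. -/
theorem prod_pow_le_or_le {K : ℕ} (x : ℝ) {d : ℕ} {α β : Fin d → ℕ} (hα : ∀ i, α i ≤ K)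
    (hβ : ∀ i, β i ≤ K) (hne : α ≠ β) :
    (∀ lam ∈ smallRegion K x d, ∏ j, lam j ^ β j ≤ x * ∏ j, lam j ^ α j) ∨
      ∀ lam ∈ smallRegion K x d, ∏ j, lam j ^ α j ≤ x * ∏ j, lam j ^ β j := by
  obtain ⟨i₀, hi₀⟩ := Function.ne_iff.1 hne
  obtain ⟨i, hi, hmax⟩ := (Finset.univ.filter fun i => α i ≠ β i).exists_max_image id
    ⟨i₀, by simpa using hi₀⟩
  simp only [Finset.mem_filter, Finset.mem_univ, true_and, id] at hi hmax
  have hgt : ∀ j, i < j → α j = β j := fun j hj => by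
    by_contra h
    exact (hmax j h).not_gt hj
  rcases lt_or_gt_of_ne hi with h | h
  · exact Or.inl fun lam hlam => prod_pow_le_of_lt hα h hgt hlam
  · exact Or.inr fun lam hlam => prod_pow_le_of_lt hβ h (fun j hj => (hgt j hj).symm) hlam

theorem sign_add_eq_of_abs_lt {a b : ℝ} (h : |b| < |a|) :
    SignType.sign (a + b) = SignType.sign a := by
  rcases lt_trichotomy a 0 with ha | rfl | ha
  · rw [abs_of_neg ha, abs_lt] at h
    rw [sign_neg ha, sign_neg (by linarith)]
  · simp at h; exact absurd h (abs_nonneg b).not_gt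
  · rw [abs_of_pos ha, abs_lt] at h
    rw [sign_pos ha, sign_pos (by linarith)]

/-- A polynomial has a constant sign on a region that is small in comparison to its degree and
coefficients. -/
theorem sign_eval_eq_of_mem_smallRegion {d : ℕ} {Q : MvPolynomial (Fin d) ℝ} {K : ℕ} {x : ℝ}
    (hx : 0 < x) (hdeg : ∀ i, Q.degreeOf i ≤ K)
    (hQ : ∀ γ ∈ Q.support, (∑ β ∈ Q.support, |Q.coeff β|) * x < |Q.coeff γ|) {lam mu : Fin d → ℝ}
    (hlam : lam ∈ smallRegion K x d) (hmu : mu ∈ smallRegion K x d) :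
    SignType.sign (Q.eval lam) = SignType.sign (Q.eval mu) := by
  rcases Q.support.eq_empty_or_nonempty with h0 | hne
  · rw [MvPolynomial.support_eq_empty.1 h0, (MvPolynomial.eval lam).map_zero, (MvPolynomial.eval mu).map_zero]
  -- The monomial that is largest at `lam` dominates on the whole region, since the order of
  -- monomials does not depend on the point.
  obtain ⟨α, hα, hmax⟩ := Q.support.exists_max_image (fun α => ∏ j, lam j ^ α j) hne
  have hbd : ∀ β ∈ Q.support, ∀ i, β i ≤ K := fun β hβ i =>
    (MvPolynomial.monomial_le_degreeOf i hβ).trans (hdeg i)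
  have hpos : ∀ nu ∈ smallRegion K x d, ∀ β : Fin d →₀ ℕ, 0 < ∏ j, nu j ^ β j :=
    fun nu hnu β => Finset.prod_pos fun j _ => pow_pos (hnu j).1 _
  -- Needed to exclude the reverse domination at `lam`, where it would contradict the maximality of
  -- `α`.
  have hx1 : x < 1 := by
    have h1 := hQ α hα
    have h2 : |Q.coeff α| ≤ ∑ β ∈ Q.support, |Q.coeff β| :=
      Finset.single_le_sum (f := fun β => |Q.coeff β|) (fun _ _ => abs_nonneg _) hα
    have h3 : 0 < |Q.coeff α| := abs_pos.2 (MvPolynomial.mem_support_iff.1 hα)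
    by_contra! h4
    nlinarith
  have hdom : ∀ β ∈ Q.support, β ≠ α → ∀ nu ∈ smallRegion K x d,
      ∏ j, nu j ^ β j ≤ x * ∏ j, nu j ^ α j := fun β hβ hne => by
    rcases prod_pow_le_or_le x (hbd α hα) (hbd β hβ)
      (fun h => hne (DFunLike.coe_injective h.symm)) with h | h
    · exact h
    · have h1 := h lam hlam
      have h2 := hmax β hβ
      have h3 := hpos lam hlam β
      nlinarith
  have hsign : ∀ nu ∈ smallRegion K x d,
      SignType.sign (Q.eval nu) = SignType.sign (Q.coeff α) := fun nu hnu => by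
    rw [MvPolynomial.eval_eq', ← Finset.add_sum_erase _ _ hα, sign_add_eq_of_abs_lt, sign_mul,
      sign_pos (hpos nu hnu α), mul_one]
    rw [abs_mul, abs_of_pos (hpos nu hnu α)]
    calc |∑ β ∈ Q.support.erase α, Q.coeff β * ∏ j, nu j ^ β j|
        ≤ ∑ β ∈ Q.support.erase α, |Q.coeff β| * (x * ∏ j, nu j ^ α j) := by
          refine (Finset.abs_sum_le_sum_abs _ _).trans (Finset.sum_le_sum fun β hβ => ?_)
          rw [abs_mul, abs_of_pos (hpos nu hnu β)]
          exact mul_le_mul_of_nonneg_left (hdom β (Finset.mem_of_mem_erase hβ)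
            (Finset.ne_of_mem_erase hβ) nu hnu) (abs_nonneg _)
      _ ≤ ∑ β ∈ Q.support, |Q.coeff β| * (x * ∏ j, nu j ^ α j) :=
          Finset.sum_le_sum_of_subset_of_nonneg (Finset.erase_subset _ _) fun β _ _ =>
            mul_nonneg (abs_nonneg _) (mul_nonneg hx.le (hpos nu hnu α).le)
      _ = ((∑ β ∈ Q.support, |Q.coeff β|) * x) * ∏ j, nu j ^ α j := by
          rw [← Finset.sum_mul, mul_assoc]
      _ < |Q.coeff α| * ∏ j, nu j ^ α j := mul_lt_mul_of_pos_right (hQ α hα) (hpos nu hnu α)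
  rw [hsign lam hlam, hsign mu hmu]

theorem exists_smallRegion_sign_eval_eq {d : ℕ} (F : Finset (MvPolynomial (Fin d) ℝ)) :
    ∃ (K : ℕ) (x : ℝ), 0 < x ∧ ∀ lam ∈ smallRegion K x d, ∀ mu ∈ smallRegion K x d, ∀ Q ∈ F,
      SignType.sign (Q.eval lam) = SignType.sign (Q.eval mu) := by
  let K := F.sup fun Q => Finset.univ.sup fun i => Q.degreeOf i
  have hK : ∀ Q ∈ F, ∀ i, Q.degreeOf i ≤ K := fun Q hQ i =>
    (Finset.le_sup (f := fun i => Q.degreeOf i) (Finset.mem_univ i)).trans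
      (Finset.le_sup (f := fun Q : MvPolynomial (Fin d) ℝ => Finset.univ.sup fun i =>
        Q.degreeOf i) hQ)
  have hx : ∀ᶠ x : ℝ in 𝓝[>] 0, ∀ Q ∈ F, ∀ γ ∈ Q.support,
      (∑ β ∈ Q.support, |Q.coeff β|) * x < |Q.coeff γ| := by
    rw [Finset.eventually_all]
    intro Q _
    rw [Finset.eventually_all]
    intro γ hγ
    refine eventually_nhdsWithin_of_eventually_nhds ?_
    have : Tendsto (fun x : ℝ => (∑ β ∈ Q.support, |Q.coeff β|) * x) (𝓝 0) (𝓝 0) := by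
      simpa using (continuous_const_mul (∑ β ∈ Q.support, |Q.coeff β|)).tendsto (0 : ℝ)
    exact this.eventually_lt_const (abs_pos.2 (MvPolynomial.mem_support_iff.1 hγ))
  obtain ⟨x, hx, hx0⟩ := (hx.and self_mem_nhdsWithin).exists
  exact ⟨K, x, hx0, fun lam hlam mu hmu Q hQ =>
    sign_eval_eq_of_mem_smallRegion hx0 (hK Q hQ) (hx Q hQ) hlam hmu⟩

end smallRegion

/-! ### Existence of iterated limits -/

/-- The property `P` holds iteratively eventually as `x₁ → 0⁺`, …, `x_d → 0⁺`. -/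
def IteratedEventually : (d : ℕ) → ((Fin d → ℝ) → Prop) → Prop
  | 0, P => P Fin.elim0
  | d + 1, P => ∀ᶠ x in 𝓝[>] (0 : ℝ), IteratedEventually d fun y => P (Fin.cons x y)

theorem IteratedEventually.mono : ∀ {d : ℕ} {P Q : (Fin d → ℝ) → Prop}, IteratedEventually d P →
    (∀ y, P y → Q y) → IteratedEventually d Q
  | 0, _, _, h, hPQ => hPQ _ h
  | _ + 1, _, _, h, hPQ => Eventually.mono h fun _ hx => IteratedEventually.mono hx fun _ => hPQ _

/-- Later variables tend to `0` with the earlier ones fixed, so they eventually meet bounds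
depending on those. Fixing the first coordinate `t` turns `x` into `x * t ^ K`. -/
theorem iteratedEventually_mem_smallRegion (K : ℕ) : ∀ (d : ℕ) {x : ℝ}, 0 < x →
    IteratedEventually d (· ∈ smallRegion K x d)
  | 0, _, _ => fun i => i.elim0
  | d + 1, x, hx => by
    have h : ∀ᶠ t : ℝ in 𝓝[>] 0, t ∈ Set.Ioc (0 : ℝ) (min 1 x) :=
      Ioc_mem_nhdsGT (lt_min one_pos hx)
    filter_upwards [h] with t ht
    exact (iteratedEventually_mem_smallRegion K d (mul_pos hx (pow_pos ht.1 K))).mono fun y hy =>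
      cons_mem_smallRegion ht.1 (ht.2.trans (min_le_left _ _)) (ht.2.trans (min_le_right _ _)) hy

theorem IsIteratedLimit.le_of_iteratedEventually : ∀ {d : ℕ} {f : (Fin d → ℝ) → ℝ} {v z : ℝ},
    IsIteratedLimit d f v → IteratedEventually d (fun y => z ≤ f y) → z ≤ v
  | 0, _, _, _, hv, hz => hz.trans_eq hv
  | _ + 1, _, _, _, ⟨_, hg, hv⟩, hz => ge_of_tendsto hv (by
      filter_upwards [hg, hz] with x hx hx' using hx.le_of_iteratedEventually hx')

theorem IsIteratedLimit.ge_of_iteratedEventually : ∀ {d : ℕ} {f : (Fin d → ℝ) → ℝ} {v z : ℝ},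
    IsIteratedLimit d f v → IteratedEventually d (fun y => f y ≤ z) → v ≤ z
  | 0, _, _, _, hv, hz => hv.symm.trans_le hz
  | _ + 1, _, _, _, ⟨_, hg, hv⟩, hz => le_of_tendsto hv (by
      filter_upwards [hg, hz] with x hx hx' using hx.ge_of_iteratedEventually hx')

/-- The superlevel sets of `f` in `(0, 1]^d` are determined by the signs of finitely many
polynomials. -/
def SignDetermined {d : ℕ} (f : (Fin d → ℝ) → ℝ) : Prop :=
  ∀ z : ℝ, ∃ F : Finset (MvPolynomial (Fin d) ℝ), ∀ lam mu : Fin d → ℝ,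
    (∀ i, lam i ∈ Set.Ioc (0 : ℝ) 1) → (∀ i, mu i ∈ Set.Ioc (0 : ℝ) 1) →
    (∀ Q ∈ F, SignType.sign (Q.eval lam) = SignType.sign (Q.eval mu)) → z ≤ f lam → z ≤ f mu

/-- Substituting the constant `t` for the first variable turns the deciding polynomials into
polynomials in the others. -/
theorem SignDetermined.cons {d : ℕ} {f : (Fin (d + 1) → ℝ) → ℝ} (hf : SignDetermined f) {t : ℝ}
    (ht : t ∈ Set.Ioc (0 : ℝ) 1) : SignDetermined fun y => f (Fin.cons t y) := by
  classical
  intro z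
  obtain ⟨F, hF⟩ := hf z
  let g : Fin (d + 1) → MvPolynomial (Fin d) ℝ := Fin.cons (MvPolynomial.C t) MvPolynomial.X
  have hg : ∀ (Q : MvPolynomial (Fin (d + 1)) ℝ) (y : Fin d → ℝ),
      (MvPolynomial.bind₁ g Q).eval y = Q.eval (Fin.cons t y) := fun Q y => by
    have h := MvPolynomial.aeval_bind₁ y g Q
    have h2 : (fun i => MvPolynomial.aeval y (g i)) = (Fin.cons t y : Fin (d + 1) → ℝ) := by
      funext i
      refine Fin.cases ?_ (fun i => ?_) i <;> simp [g]
    rw [h2] at h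
    simpa [MvPolynomial.aeval_eq_eval] using h
  refine ⟨F.image (MvPolynomial.bind₁ g), fun lam mu hlam hmu h =>
    hF _ _ (Fin.cases ht hlam) (Fin.cases ht hmu) fun Q hQ => ?_⟩
  rw [← hg, ← hg]
  exact h _ (Finset.mem_image_of_mem _ hQ)

theorem SignDetermined.dichotomy {d : ℕ} {f : (Fin d → ℝ) → ℝ} (hf : SignDetermined f) (z : ℝ) :
    IteratedEventually d (fun y => z ≤ f y) ∨ IteratedEventually d fun y => f y ≤ z := by
  obtain ⟨F, hF⟩ := hf z
  obtain ⟨K, x, hx, h⟩ := exists_smallRegion_sign_eval_eq F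
  have hR := iteratedEventually_mem_smallRegion K d hx
  by_cases hlam : ∃ lam ∈ smallRegion K x d, z ≤ f lam
  · obtain ⟨lam, hlam, hz⟩ := hlam
    exact Or.inl (hR.mono fun mu hmu => hF lam mu (smallRegion_subset_Ioc hlam)
      (smallRegion_subset_Ioc hmu) (h lam hlam mu hmu) hz)
  · push Not at hlam
    exact Or.inr (hR.mono fun mu hmu => (hlam mu hmu).le)

/-- By induction the inner limits `g t` exist. They are bounded, and the dichotomy at level `b`
prevents them from crossing an interval `[a, b]` infinitely often. -/
theorem SignDetermined.exists_isIteratedLimit {M : ℝ} : ∀ {d : ℕ} {f : (Fin d → ℝ) → ℝ},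
    SignDetermined f → (∀ y, (∀ i, y i ∈ Set.Ioc (0 : ℝ) 1) → |f y| ≤ M) →
    ∃ v, IsIteratedLimit d f v
  | 0, _, _, _ => ⟨_, rfl⟩
  | d + 1, f, hf, hM => by
    have hM' : ∀ t ∈ Set.Ioc (0 : ℝ) 1, ∀ y : Fin d → ℝ, (∀ i, y i ∈ Set.Ioc (0 : ℝ) 1) →
        |f (Fin.cons t y)| ≤ M := fun t ht y hy => hM _ (Fin.cases ht hy)
    have hex : ∀ t, ∃ v, t ∈ Set.Ioc (0 : ℝ) 1 → IsIteratedLimit d (fun y => f (Fin.cons t y)) v :=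
      fun t => by
        by_cases ht : t ∈ Set.Ioc (0 : ℝ) 1
        · obtain ⟨v, hv⟩ := (hf.cons ht).exists_isIteratedLimit (hM' t ht)
          exact ⟨v, fun _ => hv⟩
        · exact ⟨0, fun h => absurd h ht⟩
    choose g hg using hex
    have hIoc : ∀ᶠ t : ℝ in 𝓝[>] 0, t ∈ Set.Ioc (0 : ℝ) 1 := Ioc_mem_nhdsGT one_pos
    have hlow : ∀ z, IteratedEventually (d + 1) (fun y => z ≤ f y) → ∀ᶠ t in 𝓝[>] 0, z ≤ g t :=
      fun z hz => by
        filter_upwards [hIoc, hz] with t ht hzt using (hg t ht).le_of_iteratedEventually hzt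
    have hup : ∀ z, IteratedEventually (d + 1) (fun y => f y ≤ z) → ∀ᶠ t in 𝓝[>] 0, g t ≤ z :=
      fun z hz => by
        filter_upwards [hIoc, hz] with t ht hzt using (hg t ht).ge_of_iteratedEventually hzt
    have hbd : IteratedEventually (d + 1) fun y => |f y| ≤ M :=
      (iteratedEventually_mem_smallRegion 0 (d + 1) one_pos).mono fun y hy =>
        hM y (smallRegion_subset_Ioc hy)
    obtain ⟨v, hv⟩ := tendsto_of_no_upcrossings (f := 𝓝[>] (0 : ℝ)) (u := g) dense_univ
      (fun a _ b _ hab h => by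
        rcases hf.dichotomy b with hb | hb
        · obtain ⟨t, h1, h2⟩ := (h.1.and_eventually (hlow b hb)).exists
          linarith
        · obtain ⟨t, h1, h2⟩ := (h.2.and_eventually (hup b hb)).exists
          linarith)
      ⟨M, by simpa using hup M (hbd.mono fun y hy => (abs_le.1 hy).2)⟩
      ⟨-M, by simpa using hlow (-M) (hbd.mono fun y hy => (abs_le.1 hy).1)⟩
    exact ⟨v, g, by filter_upwards [hIoc] with t ht using hg t ht, hv⟩

/-- Each decay bound holds with equality: `1 + K * ∑ j < i, (K + 1) ^ j = (K + 1) ^ i`. This is the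
reason for the exponents `(n D + 1) ^ (i - 1)`. -/
theorem discountFactors_mem_smallRegion (S A B : Type*) (b : ℕ) (ε : ℚ) (d : ℕ) :
    (discountFactors S A B b ε : Fin d → ℝ) ∈ smallRegion (Nat.card S * stratBound S A B)
      (Real.exp (-(expBound S A B b ε : ℝ))) d := by
  intro i
  refine ⟨Real.exp_pos _, Real.exp_le_one_iff.2 (by rw [neg_nonpos]; positivity), le_of_eq ?_⟩
  set K := Nat.card S * stratBound S A B
  set c : ℝ := (expBound S A B b ε : ℝ)
  have hK : (Nat.card S : ℝ) * (stratBound S A B : ℝ) = K := by simp [K]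
  simp only [discountFactors, hK]
  let F : ℕ → ℝ := fun j => Real.exp (-(c * ((K : ℝ) + 1) ^ j)) ^ K
  have h1 : ∀ k, ∏ j ∈ Finset.range k, F j = Real.exp (-(c * (((K : ℝ) + 1) ^ k - 1))) := fun k => by
    induction k with
    | zero => simp
    | succ k ih =>
      have hF : F k = Real.exp (K * -(c * ((K : ℝ) + 1) ^ k)) := (Real.exp_nat_mul _ _).symm
      rw [Finset.prod_range_succ, ih, hF, ← Real.exp_add]
      congr 1
      ring
  have h2 : (∏ j : Fin d, if j < i then Real.exp (-(c * ((K : ℝ) + 1) ^ (j : ℕ))) ^ K else 1) =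
      ∏ j ∈ Finset.range i, F j := by
    have h := Fin.prod_univ_eq_prod_range (fun j => if j < (i : ℕ) then F j else 1) d
    simp only [Fin.lt_def]
    rw [h, ← Finset.prod_filter]
    congr 1
    ext j
    simp only [Finset.mem_filter, Finset.mem_range]
    have := i.isLt
    omega
  rw [h2, h1, ← Real.exp_add]
  congr 1
  ring

/-! ### Degrees and coefficient sums of integer polynomials -/

namespace MvPolynomial

variable {d : ℕ}

/-- The sum of the absolute values of the coefficients. -/
noncomputable def coeffNorm (Q : MvPolynomial (Fin d) ℝ) : ℝ := ∑ γ ∈ Q.support, |Q.coeff γ|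

theorem coeffNorm_eq_sum {Q : MvPolynomial (Fin d) ℝ} {T : Finset (Fin d →₀ ℕ)}
    (hT : Q.support ⊆ T) : coeffNorm Q = ∑ γ ∈ T, |Q.coeff γ| :=
  Finset.sum_subset hT fun γ _ hγ => by rw [notMem_support_iff.1 hγ, abs_zero]

theorem coeffNorm_nonneg (Q : MvPolynomial (Fin d) ℝ) : 0 ≤ coeffNorm Q :=
  Finset.sum_nonneg fun _ _ => abs_nonneg _

theorem coeffNorm_neg (Q : MvPolynomial (Fin d) ℝ) : coeffNorm (-Q) = coeffNorm Q := by
  simp [coeffNorm, support_neg, coeff_neg]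

theorem coeffNorm_add_le (P Q : MvPolynomial (Fin d) ℝ) :
    coeffNorm (P + Q) ≤ coeffNorm P + coeffNorm Q := by
  classical
  rw [coeffNorm_eq_sum (support_add (p := P) (q := Q)),
    coeffNorm_eq_sum (Finset.subset_union_left (s₁ := P.support) (s₂ := Q.support)),
    coeffNorm_eq_sum (Finset.subset_union_right (s₁ := P.support) (s₂ := Q.support)),
    ← Finset.sum_add_distrib]
  exact Finset.sum_le_sum fun γ _ => by rw [coeff_add]; exact abs_add_le _ _

theorem coeffNorm_sum_le {ι : Type*} (s : Finset ι) (f : ι → MvPolynomial (Fin d) ℝ) :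
    coeffNorm (∑ i ∈ s, f i) ≤ ∑ i ∈ s, coeffNorm (f i) :=
  Finset.le_sum_of_subadditive _ (by simp [coeffNorm]) coeffNorm_add_le _ _

theorem coeffNorm_monomial_le (γ : Fin d →₀ ℕ) (c : ℝ) : coeffNorm (monomial γ c) ≤ |c| := by
  classical
  rw [coeffNorm_eq_sum support_monomial_subset, Finset.sum_singleton, coeff_monomial, if_pos rfl]

theorem coeffNorm_mul_le (P Q : MvPolynomial (Fin d) ℝ) :
    coeffNorm (P * Q) ≤ coeffNorm P * coeffNorm Q := by
  conv_lhs => rw [P.as_sum, Q.as_sum, Finset.sum_mul_sum]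
  rw [show coeffNorm P * coeffNorm Q = (∑ α ∈ P.support, |P.coeff α|) *
    ∑ β ∈ Q.support, |Q.coeff β| from rfl, Finset.sum_mul_sum]
  refine (coeffNorm_sum_le _ _).trans (Finset.sum_le_sum fun α _ => (coeffNorm_sum_le _ _).trans
    (Finset.sum_le_sum fun β _ => ?_))
  rw [monomial_mul, ← abs_mul]
  exact coeffNorm_monomial_le _ _

/-- `Q` has integer coefficients, degree at most `a` in each variable, and the absolute values of
its coefficients sum up to at most `L`. -/
structure IntBound (a : ℕ) (L : ℝ) (Q : MvPolynomial (Fin d) ℝ) : Prop where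
  mem_range : Q ∈ (map (σ := Fin d) (Int.castRingHom ℝ)).range
  degreeOf_le : ∀ i, Q.degreeOf i ≤ a
  coeffNorm_le : coeffNorm Q ≤ L

theorem IntBound.prod {ι : Type*} {a : ℕ} {L : ℝ} (s : Finset ι)
    {f : ι → MvPolynomial (Fin d) ℝ} (hf : ∀ i ∈ s, IntBound a L (f i)) :
    IntBound (s.card * a) (L ^ s.card) (∏ i ∈ s, f i) := by
  classical
  induction s using Finset.induction_on with
  | empty =>
    refine ⟨by simp [one_mem], fun i => by simp, ?_⟩
    simpa using coeffNorm_monomial_le (d := d) 0 1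
  | insert i s hi ih =>
    have h1 := hf i (Finset.mem_insert_self i s)
    have h2 := ih fun j hj => hf j (Finset.mem_insert_of_mem hj)
    rw [Finset.prod_insert hi, Finset.card_insert_of_notMem hi]
    refine ⟨mul_mem h1.1 h2.1, fun j => (degreeOf_mul_le _ _ _).trans ?_,
      (coeffNorm_mul_le _ _).trans ?_⟩
    · have := h1.2 j
      have := h2.2 j
      linarith
    · rw [pow_succ']
      exact mul_le_mul h1.3 h2.3 (coeffNorm_nonneg _) ((coeffNorm_nonneg _).trans h1.3)

theorem IntBound.det {ι : Type*} [Fintype ι] [DecidableEq ι] {a : ℕ} {L : ℝ}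
    {M : Matrix ι ι (MvPolynomial (Fin d) ℝ)} (hM : ∀ i j, IntBound a L (M i j)) :
    IntBound (Fintype.card ι * a) ((Fintype.card ι).factorial * L ^ Fintype.card ι) M.det := by
  have h : ∀ σ : Equiv.Perm ι, IntBound (Fintype.card ι * a) (L ^ Fintype.card ι)
      (Equiv.Perm.sign σ • ∏ i, M (σ i) i) := fun σ => by
    have h1 := IntBound.prod Finset.univ fun i _ => hM (σ i) i
    rw [Finset.card_univ] at h1
    rcases Int.units_eq_one_or (Equiv.Perm.sign σ) with hσ | hσ
    · rwa [hσ, one_smul]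
    · rw [hσ, Units.neg_smul, one_smul]
      exact ⟨neg_mem h1.1, fun i => by rw [degreeOf_neg]; exact h1.2 i,
        by rw [coeffNorm_neg]; exact h1.3⟩
  rw [Matrix.det_apply]
  refine ⟨sum_mem fun σ _ => (h σ).1, fun i => (degreeOf_sum_le _ _ _).trans
    (Finset.sup_le fun σ _ => (h σ).2 i), (coeffNorm_sum_le _ _).trans
    ((Finset.sum_le_sum fun σ _ => (h σ).3).trans_eq ?_)⟩
  rw [Finset.sum_const, Finset.card_univ, Fintype.card_perm, nsmul_eq_mul]

theorem intBound_linear (u v : ℤ) (i : Fin d) {L : ℝ} (h : |(u : ℝ)| + |(v : ℝ)| ≤ L) :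
    IntBound 1 L (C (u : ℝ) + C (v : ℝ) * X i) := by
  refine ⟨⟨C u + C v * X i, by simp⟩, fun j => ?_, (coeffNorm_add_le _ _).trans (le_trans ?_ h)⟩
  · refine (degreeOf_add_le _ _ _).trans (max_le ((degreeOf_C _ _).trans_le zero_le_one) ((degreeOf_C_mul_le _ _ _).trans ?_))
    rw [degreeOf_X]
    split_ifs <;> simp
  · refine add_le_add (coeffNorm_monomial_le _ _) ?_
    rw [X, C_mul_monomial, mul_one]
    exact coeffNorm_monomial_le _ _

/-- A nonzero integer coefficient is at least `1` in absolute value, so `L * x < 1` suffices for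
domination. -/
theorem IntBound.sign_eval_eq {a : ℕ} {L : ℝ} {Q : MvPolynomial (Fin d) ℝ} (hQ : IntBound a L Q)
    {K : ℕ} (hK : a ≤ K) {x : ℝ} (hx : 0 < x) (hxL : L * x < 1) {lam mu : Fin d → ℝ}
    (hlam : lam ∈ smallRegion K x d) (hmu : mu ∈ smallRegion K x d) :
    SignType.sign (Q.eval lam) = SignType.sign (Q.eval mu) := by
  refine sign_eval_eq_of_mem_smallRegion hx (fun i => (hQ.2 i).trans hK) (fun γ hγ => ?_) hlam hmu
  refine ((mul_le_mul_of_nonneg_right hQ.3 hx.le).trans_lt hxL).trans_le ?_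
  obtain ⟨P, rfl⟩ := hQ.1
  rw [mem_support_iff, coeff_map] at hγ
  rw [coeff_map]
  simp only [eq_intCast, ne_eq, Int.cast_eq_zero] at hγ ⊢
  exact_mod_cast Int.one_le_abs hγ

end MvPolynomial

theorem Matrix.HasNonnegCombination.of_pos_mul {I J : Type*} [Fintype I] {W W' : Matrix I J ℝ}
    (h : W.HasNonnegCombination) {c : ℝ} (hc : 0 < c) (hW : ∀ i j, W' i j = c * W i j) :
    W'.HasNonnegCombination := by
  obtain ⟨x, h1, h2, h3⟩ := h
  refine ⟨x, h1, h2, fun j => ?_⟩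
  simp only [hW, mul_left_comm _ c, ← Finset.mul_sum]
  exact mul_nonneg hc.le (h3 j)

theorem CSG.abs_value_le {S A B : Type*} [Fintype S] [Fintype A] [Fintype B] [Nonempty A]
    [Nonempty B] (G : CSG S A B) {r : S → A → B → ℝ} {Λ : S → ℝ}
    (hΛ : ∀ s, Λ s ∈ Set.Ioc (0 : ℝ) 1) {M : ℝ} (hM : ∀ s a b, |r s a b| ≤ M) (k : S) : |G.value r Λ k| ≤ M := by
  have hp := fun s a b => (G.δ s a b).toReal_mem_stdSimplex
  obtain ⟨w, x, y, h⟩ := exists_isShapleySolution hp r (fun s => (hΛ s).1) fun s => (hΛ s).2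
  rw [G.value_eq_of_isShapleySolution k (fun s => (hΛ s).1) (fun s => (hΛ s).2) h]
  exact h.abs_value_le hp (fun s => (hΛ s).1) (fun s => (hΛ s).2) hM k

/-! ### The value compared with a level through polynomial minors -/

section gamePoly

variable {S A B : Type*} [Fintype S] [DecidableEq S] {d : ℕ}

/-- The matrix of the determinants of the polynomial matrices with entries
`u s a b s' + v s a b s' * X (χ s)`, for the pairs of pure stationary strategies. -/
noncomputable def gamePoly (u v : S → A → B → S → ℝ) (χ : S → Fin d) :
    Matrix (S → A) (S → B) (MvPolynomial (Fin d) ℝ) :=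
  Matrix.of fun i j => (Matrix.of fun s s' => MvPolynomial.C (u s (i s) (j s) s') +
    MvPolynomial.C (v s (i s) (j s) s') * MvPolynomial.X (χ s)).det

/-- `u` and `v` describe the entries of the matrices whose determinants make up `gameMatrix`, up to
positive factors `ρ` of the rows and `κ` of the columns. -/
def IsGamePolyCoeff (p : S → A → B → S → ℝ) (r : S → A → B → ℝ) (k : S) (z : ℝ)
    (u v : S → A → B → S → ℝ) (ρ κ : S → ℝ) : Prop :=
  (∀ s, 0 < ρ s) ∧ (∀ s, 0 < κ s) ∧ ∀ (l : ℝ) s a b s', u s a b s' + v s a b s' * l =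
    ρ s * (κ s' * if s' = k then l * (r s a b - z) else
      (if s = s' then 1 else 0) - (1 - l) * p s a b s')

theorem eval_gamePoly {p : S → A → B → S → ℝ} {r : S → A → B → ℝ} {k : S} {z : ℝ}
    {u v : S → A → B → S → ℝ} {ρ κ : S → ℝ} (h : IsGamePolyCoeff p r k z u v ρ κ) (χ : S → Fin d)
    (lam : Fin d → ℝ) (i : S → A) (j : S → B) :
    (gamePoly u v χ i j).eval lam =
      ((∏ s, ρ s) * ∏ s, κ s) * gameMatrix p r (fun s => lam (χ s)) k z i j := by
  rw [gamePoly, gameMatrix, Matrix.of_apply, Matrix.of_apply, RingHom.map_det, mul_assoc,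
    ← Matrix.det_mul_row, ← Matrix.det_mul_column]
  congr 1
  ext s s'
  simp only [RingHom.mapMatrix_apply, Matrix.map_apply, Matrix.of_apply, map_add, map_mul,
    MvPolynomial.eval_C, MvPolynomial.eval_X, h.2.2, Matrix.updateCol_apply, discountMatrix]

variable [Fintype A] [Fintype B] [Nonempty A] [Nonempty B] (G : CSG S A B)

theorem CSG.le_value_iff {r : S → A → B → ℝ} {Λ : S → ℝ} (hΛ : ∀ s, Λ s ∈ Set.Ioc (0 : ℝ) 1)
    (k : S) (z : ℝ) : z ≤ G.value r Λ k ↔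
      (gameMatrix (fun s a b s' => (G.δ s a b s').toReal) r Λ k z).HasNonnegCombination := by
  have hp := fun s a b => (G.δ s a b).toReal_mem_stdSimplex
  obtain ⟨w, x, y, h⟩ := exists_isShapleySolution hp r (fun s => (hΛ s).1) fun s => (hΛ s).2
  rw [G.value_eq_of_isShapleySolution k (fun s => (hΛ s).1) (fun s => (hΛ s).2) h]
  exact h.le_iff hp (fun s => (hΛ s).1) (fun s => (hΛ s).2) k z

/-- Up to a positive factor `gameMatrix` is an evaluation of `gamePoly`, and evaluation commutes
with minors. -/
theorem CSG.le_value_of_sign_eq {r : S → A → B → ℝ} {k : S} {z : ℝ} {u v : S → A → B → S → ℝ}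
    {ρ κ : S → ℝ} (h : IsGamePolyCoeff (fun s a b s' => (G.δ s a b s').toReal) r k z u v ρ κ)
    (χ : S → Fin d) {lam mu : Fin d → ℝ} (hlam : ∀ i, lam i ∈ Set.Ioc (0 : ℝ) 1)
    (hmu : ∀ i, mu i ∈ Set.Ioc (0 : ℝ) 1)
    (hsign : ∀ m ≤ Fintype.card (S → A), ∀ (e : Fin m → S → A) (f : Fin m → S → B),
      SignType.sign (((gamePoly u v χ).submatrix e f).det.eval lam) =
        SignType.sign (((gamePoly u v χ).submatrix e f).det.eval mu))
    (hz : z ≤ G.value r (fun s => lam (χ s)) k) : z ≤ G.value r (fun s => mu (χ s)) k := by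
  rw [G.le_value_iff (fun s => hmu _)]
  rw [G.le_value_iff (fun s => hlam _)] at hz
  have hc : 0 < (∏ s, ρ s) * ∏ s, κ s :=
    mul_pos (Finset.prod_pos fun s _ => h.1 s) (Finset.prod_pos fun s _ => h.2.1 s)
  have h1 := hz.of_pos_mul hc (W' := (gamePoly u v χ).map (MvPolynomial.eval lam))
    (eval_gamePoly h χ lam)
  have h2 := h1.of_sign_minors_eq (W' := (gamePoly u v χ).map (MvPolynomial.eval mu))
    fun m hm e f => by
      have := hsign m hm e f
      rw [RingHom.map_det, RingHom.map_det] at this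
      exact this
  refine h2.of_pos_mul (inv_pos.2 hc) fun i j => ?_
  rw [Matrix.map_apply, eval_gamePoly h, inv_mul_cancel_left₀ hc.ne']

theorem CSG.signDetermined_value (r : S → A → B → ℝ) (χ : S → Fin d) (k : S) :
    SignDetermined fun lam : Fin d → ℝ => G.value r (fun s => lam (χ s)) k := by
  classical
  intro z
  let u : S → A → B → S → ℝ := fun s a b s' =>
    if s' = k then 0 else (if s = s' then 1 else 0) - (G.δ s a b s').toReal
  let v : S → A → B → S → ℝ := fun s a b s' =>
    if s' = k then r s a b - z else (G.δ s a b s').toReal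
  have h : IsGamePolyCoeff (fun s a b s' => (G.δ s a b s').toReal) r k z u v 1 1 := by
    refine ⟨fun _ => one_pos, fun _ => one_pos, fun l s a b s' => ?_⟩
    simp only [u, v, Pi.one_apply, one_mul]
    split_ifs <;> ring
  refine ⟨(Finset.range (Fintype.card (S → A) + 1)).biUnion fun m => Finset.univ.image
    fun ef : (Fin m → S → A) × (Fin m → S → B) => ((gamePoly u v χ).submatrix ef.1 ef.2).det,
    fun lam mu hlam hmu hsign => G.le_value_of_sign_eq h χ hlam hmu fun m hm e f => hsign _ ?_⟩
  exact Finset.mem_biUnion.2 ⟨m, Finset.mem_range.2 (by omega),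
    Finset.mem_image.2 ⟨(e, f), Finset.mem_univ _, rfl⟩⟩

end gamePoly

/-! ### Bit-size estimates -/

theorem lt_two_pow_bit (k : ℕ) : k < 2 ^ bit k :=
  Nat.le_pow_clog one_lt_two (k + 1)

theorem one_le_bit {k : ℕ} (hk : 0 < k) : 1 ≤ bit k :=
  Nat.clog_pos one_lt_two (by omega)

theorem factorial_le_two_pow (k : ℕ) : k.factorial ≤ 2 ^ (k * bit k) := by
  rw [mul_comm, pow_mul]
  exact k.factorial_le_pow.trans (Nat.pow_le_pow_left (lt_two_pow_bit k).le k)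

/-- The left side bounds the coefficient sum of an order `m` minor whose entries are `n × n`
determinants of linear polynomials of norm at most `2 ^ E`. -/
theorem factorial_mul_pow_le {n D m : ℕ} (hm : m ≤ D) (E : ℕ) :
    m.factorial * (n.factorial * (2 ^ E) ^ n) ^ m ≤ 2 ^ (D * bit D + D * (n * (bit n + E))) := by
  have h1 : n.factorial * (2 ^ E) ^ n ≤ 2 ^ (n * (bit n + E)) := by
    refine (Nat.mul_le_mul_right _ (factorial_le_two_pow n)).trans_eq ?_
    rw [← pow_mul, ← pow_add]
    congr 1
    ring
  have h2 : (n.factorial * (2 ^ E) ^ n) ^ m ≤ 2 ^ (D * (n * (bit n + E))) := by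
    refine (Nat.pow_le_pow_left h1 m).trans ?_
    rw [← pow_mul, mul_comm D]
    exact Nat.pow_le_pow_right two_pos (Nat.mul_le_mul_left _ hm)
  rw [pow_add]
  exact Nat.mul_le_mul ((Nat.factorial_le hm).trans (factorial_le_two_pow D)) h2

theorem two_pow_lt_exp {S A B : Type*} {b : ℕ} {ε : ℚ} (hn : 0 < Nat.card S)
    (hD : 0 < stratBound S A B) :
    (2 : ℝ) ^ (stratBound S A B * bit (stratBound S A B) + stratBound S A B *
      (Nat.card S * (bit (Nat.card S) + (3 * b + bitRat ε + 3)))) <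
      Real.exp (expBound S A B b ε) := by
  unfold expBound
  set n := Nat.card S
  set D := stratBound S A B
  have h1 := one_le_bit hn
  have h2 := one_le_bit hD
  have hlt : D * bit D + D * (n * (bit n + (3 * b + bitRat ε + 3))) <
      11 * D * n * (b + bit n + bit D + bitRat ε) := by
    calc D * bit D + D * (n * (bit n + (3 * b + bitRat ε + 3)))
        ≤ D * (n * bit D) + D * (n * (bit n + (3 * b + bitRat ε + 3))) :=
          Nat.add_le_add_right (Nat.mul_le_mul_left _ (Nat.le_mul_of_pos_left _ hn)) _
      _ = D * n * (bit D + bit n + 3 * b + bitRat ε + 3) := by ring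
      -- The additive `3` is absorbed by `bit n ≥ 1` and `bit D ≥ 1`.
      _ < D * n * (11 * (b + bit n + bit D + bitRat ε)) :=
          Nat.mul_lt_mul_of_pos_left (by omega) (Nat.mul_pos hD hn)
      _ = _ := by ring
  calc (2 : ℝ) ^ (D * bit D + D * (n * (bit n + (3 * b + bitRat ε + 3))))
      ≤ Real.exp 1 ^ (D * bit D + D * (n * (bit n + (3 * b + bitRat ε + 3)))) :=
        pow_le_pow_left₀ two_pos.le (by linarith [Real.add_one_le_exp 1]) _
    _ = Real.exp ((D * bit D + D * (n * (bit n + (3 * b + bitRat ε + 3))) : ℕ) : ℝ) := by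
        rw [← Real.exp_nat_mul, mul_one]
    _ < _ := Real.exp_lt_exp.2 (Nat.cast_lt.2 hlt)

/-- Integer coefficients of the polynomial matrices when the data are rational. -/
theorem exists_isGamePolyCoeff {S A B : Type*} [DecidableEq S] {b : ℕ} {p : S → A → B → S → ℝ}
    {r : S → A → B → ℝ} (hp : ∀ s, HasBitSize b fun x : A × B × S => p s x.1 x.2.1 x.2.2)
    (hr : ∀ s, HasBitSize b fun x : A × B => r s x.1 x.2) (k : S) (zn : ℤ) {zd : ℕ}
    (hzd : 0 < zd) :
    ∃ (u v : S → A → B → S → ℤ) (ρ κ : S → ℝ),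
      IsGamePolyCoeff p r k (zn / zd) (fun s a b s' => (u s a b s' : ℝ))
        (fun s a b s' => (v s a b s' : ℝ)) ρ κ ∧
      ∀ s a b' s', |u s a b' s'| + |v s a b' s'| ≤ 2 ^ (2 * b) * (2 + zd + |zn|) := by
  choose q hq0 hq f hf hfp using hp
  choose q' hq0' hq' g hg hgr using hr
  -- Row `s` is scaled by both common denominators `q s * q' s`, and column `k` by the denominator
  -- `zd` of the level.
  refine ⟨fun s a b s' => if s' = k then 0 else
      q' s * ((if s = s' then (q s : ℤ) else 0) - f s (a, b, s')),
    fun s a b s' => if s' = k then q s * (zd * g s (a, b) - q' s * zn) else q' s * f s (a, b, s'),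
    fun s => q s * q' s, fun s' => if s' = k then zd else 1, ⟨fun s => ?_, fun s => ?_, ?_⟩, ?_⟩
  · have := hq0 s
    have := hq0' s
    positivity
  · have : (0 : ℝ) < zd := by exact_mod_cast hzd
    dsimp only
    split_ifs <;> simp [this]
  · intro l s a b s'
    have h1 := hfp s (a, b, s')
    have h2 := hgr s (a, b)
    have h3 : (q s : ℝ) ≠ 0 := by exact_mod_cast (hq0 s).ne'
    have h4 : (q' s : ℝ) ≠ 0 := by exact_mod_cast (hq0' s).ne'
    have h5 : (zd : ℝ) ≠ 0 := by exact_mod_cast hzd.ne'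
    dsimp only at h1 h2 ⊢
    rw [h1, h2]
    split_ifs <;> push_cast <;> field_simp <;> ring
  · intro s a b' s'
    have hY : (2 : ℤ) ^ (2 * b) = 2 ^ b * 2 ^ b := by rw [two_mul, pow_add]
    have h1 : ((q s : ℕ) : ℤ) ≤ 2 ^ b := by exact_mod_cast hq s
    have h2 : ((q' s : ℕ) : ℤ) ≤ 2 ^ b := by exact_mod_cast hq' s
    have h3 := hf s (a, b', s')
    have h4 := hg s (a, b')
    have hpos : (0 : ℤ) < 2 ^ b := by positivity
    rw [hY]
    dsimp only
    by_cases hs : s' = k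
    · rw [if_pos hs, if_pos hs, abs_zero, zero_add, abs_mul, Nat.abs_cast]
      have h5 : |(zd : ℤ) * g s (a, b') - q' s * zn| ≤ 2 ^ b * (zd + |zn|) := by
        refine (abs_sub _ _).trans ?_
        rw [abs_mul, abs_mul, Nat.abs_cast, Nat.abs_cast]
        nlinarith [mul_le_mul_of_nonneg_left h4 (Int.natCast_nonneg zd),
          mul_le_mul_of_nonneg_right h2 (abs_nonneg zn)]
      calc (q s : ℤ) * |(zd : ℤ) * g s (a, b') - q' s * zn| ≤ 2 ^ b * (2 ^ b * (zd + |zn|)) :=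
            mul_le_mul h1 h5 (abs_nonneg _) hpos.le
        _ ≤ _ := by nlinarith
    · rw [if_neg hs, if_neg hs, abs_mul, abs_mul, Nat.abs_cast, ← mul_add]
      have h5 : |(if s = s' then (q s : ℤ) else 0) - f s (a, b', s')| ≤ 2 ^ b + 2 ^ b := by
        refine (abs_sub _ _).trans (add_le_add ?_ h3)
        split_ifs
        · rwa [Nat.abs_cast]
        · rw [abs_zero]; exact hpos.le
      have h6 : (1 : ℤ) ≤ zd := by exact_mod_cast hzd
      calc (q' s : ℤ) * (|(if s = s' then (q s : ℤ) else 0) - f s (a, b', s')| +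
            |f s (a, b', s')|) ≤ 2 ^ b * (2 ^ b + 2 ^ b + 2 ^ b) :=
            mul_le_mul h2 (add_le_add h5 h3) (by positivity) hpos.le
        _ = 2 ^ b * 2 ^ b * (2 + 1 + 0) := by ring
        _ ≤ _ := mul_le_mul_of_nonneg_left (by linarith [abs_nonneg zn]) (by positivity)

/-! ### Comparison of the value at `λ⁰` with the limit -/

section approximation

variable {S A B : Type*} [Fintype S] [DecidableEq S] [Fintype A] [Fintype B] [Nonempty A]
  [Nonempty B] (G : CSG S A B) {r : S → A → B → ℝ} {b : ℕ} {d : ℕ}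

/-- Comparisons of the value with rationals of bounded size have the same result throughout the
small region. -/
theorem CSG.le_value_of_mem_smallRegion
    (hδ : ∀ s₁ : S, HasBitSize b fun x : A × B × S => (G.δ s₁ x.1 x.2.1 x.2.2).toReal)
    (hr : ∀ s₁ : S, HasBitSize b fun x : A × B => r s₁ x.1 x.2) (χ : S → Fin d) (k : S) (ε : ℚ)
    {zn : ℤ} (hzn : |zn| ≤ 2 ^ b * ε.den + 1) {lam mu : Fin d → ℝ}
    (hlam : lam ∈ smallRegion (Nat.card S * stratBound S A B)
      (Real.exp (-(expBound S A B b ε : ℝ))) d)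
    (hmu : mu ∈ smallRegion (Nat.card S * stratBound S A B)
      (Real.exp (-(expBound S A B b ε : ℝ))) d)
    (hz : (zn / ε.den : ℝ) ≤ G.value r (fun s => lam (χ s)) k) :
    (zn / ε.den : ℝ) ≤ G.value r (fun s => mu (χ s)) k := by
  obtain ⟨u, v, ρ, κ, h, huv⟩ := exists_isGamePolyCoeff
    (p := fun s a b s' => (G.δ s a b s').toReal) hδ hr k zn ε.den_pos
  refine G.le_value_of_sign_eq h χ (smallRegion_subset_Ioc hlam) (smallRegion_subset_Ioc hmu)
    (fun m hm e f => ?_) hz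
  -- The entries are bounded by `2 ^ (2 * b) * (2 + ε.den + |zn|)` with `|zn| ≤ 2 ^ b * ε.den + 1`;
  -- the last factor is at most `8 * 2 ^ b * 2 ^ bitRat ε`.
  set E := 3 * b + bitRat ε + 3 with hE
  have huvE : ∀ s a b' s', |(u s a b' s' : ℝ)| + |(v s a b' s' : ℝ)| ≤ 2 ^ E := fun s a b' s' => by
    have h1 : (ε.den : ℤ) ≤ 2 ^ bitRat ε := by
      have h2 : ε.den ≤ 2 ^ bitRat ε := (lt_two_pow_bit _).le.trans
        (Nat.pow_le_pow_right two_pos (Nat.le_add_left _ _))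
      exact_mod_cast h2
    have h2 : (2 : ℤ) ^ E = 2 ^ (2 * b) * (8 * (2 ^ b * 2 ^ bitRat ε)) := by
      rw [hE]; ring
    have h3 : (1 : ℤ) ≤ 2 ^ b := one_le_pow₀ one_le_two
    have h4 : (1 : ℤ) ≤ 2 ^ bitRat ε := one_le_pow₀ one_le_two
    have h5 : |u s a b' s'| + |v s a b' s'| ≤ 2 ^ E := by
      rw [h2]
      refine (huv s a b' s').trans (mul_le_mul_of_nonneg_left ?_ (by positivity))
      nlinarith [mul_le_mul_of_nonneg_left h1 (show (0 : ℤ) ≤ 2 ^ b by positivity)]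
    exact_mod_cast h5
  have hcard : Fintype.card (S → A) ≤ stratBound S A B := by
    rw [← Nat.card_eq_fintype_card]
    exact le_max_left _ _
  have hQ : MvPolynomial.IntBound (m * Nat.card S) (m.factorial *
      ((Nat.card S).factorial * (2 ^ E) ^ Nat.card S) ^ m) ((gamePoly (fun s a b s' => (u s a b s' : ℝ))
        (fun s a b s' => (v s a b s' : ℝ)) χ).submatrix e f).det := by
    have h1 := MvPolynomial.IntBound.det (M := (gamePoly (fun s a b s' => (u s a b s' : ℝ))
        (fun s a b s' => (v s a b s' : ℝ)) χ).submatrix e f) fun i j =>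
      MvPolynomial.IntBound.det (M := Matrix.of fun s s' =>
        MvPolynomial.C (u s (e i s) (f j s) s' : ℝ) +
        MvPolynomial.C (v s (e i s) (f j s) s' : ℝ) * MvPolynomial.X (χ s)) fun s s' =>
        MvPolynomial.intBound_linear _ _ (χ s) (huvE s (e i s) (f j s) s')
    simpa only [Fintype.card_fin, mul_one, Nat.card_eq_fintype_card] using h1
  refine hQ.sign_eval_eq ?_ (Real.exp_pos _) ?_ hlam hmu
  · rw [mul_comm]
    exact Nat.mul_le_mul_left _ (hm.trans hcard)
  · have : Nonempty S := ⟨k⟩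
    have h1 := factorial_mul_pow_le (n := Nat.card S) (hm.trans hcard) E
    have h2 := two_pow_lt_exp (A := A) (B := B) (b := b) (ε := ε) (Nat.card_pos (α := S))
      (Fintype.card_pos.trans_le hcard)
    rw [Real.exp_neg, ← div_eq_mul_inv, div_lt_one (Real.exp_pos _)]
    refine lt_of_le_of_lt ?_ h2
    exact_mod_cast h1

end approximation

theorem HasBitSize.abs_le {ι : Type*} {b : ℕ} {f : ι → ℝ} (h : HasBitSize b f) (i : ι) :
    |f i| ≤ 2 ^ b := by
  obtain ⟨q, hq0, -, hf⟩ := h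
  obtain ⟨k, hk, hki⟩ := hf i
  have h1 : (1 : ℝ) ≤ q := by exact_mod_cast hq0
  have h2 : |(k : ℝ)| ≤ 2 ^ b := by exact_mod_cast hk
  rw [hki, abs_div, Nat.abs_cast]
  exact (div_le_self (abs_nonneg _) h1).trans h2

theorem mainTheorem1 {S A B : Type*} [Finite S] [Finite A] [Finite B] [Nonempty A] [Nonempty B]
    (G : CSG S A B) (s : S) (r : S → A → B → ℝ) {d : ℕ} (χ : S → Fin d)
    (ε : ℚ) (hε : 0 < ε) (b : ℕ)
    (hδ : ∀ s₁ : S, HasBitSize b fun x : A × B × S => (G.δ s₁ x.1 x.2.1 x.2.2).toReal)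
    (hr : ∀ s₁ : S, HasBitSize b fun x : A × B => r s₁ x.1 x.2) :
    ∃ v : ℝ, G.IsLimitValue r χ s v ∧
      |G.value r (fun s' => discountFactors S A B b ε (χ s')) s - v| ≤ (ε : ℝ) := by
  classical
  have := Fintype.ofFinite S
  have := Fintype.ofFinite A
  have := Fintype.ofFinite B
  have hbd : ∀ lam : Fin d → ℝ, (∀ i, lam i ∈ Set.Ioc (0 : ℝ) 1) →
      |G.value r (fun s' => lam (χ s')) s| ≤ 2 ^ b := fun lam hlam =>
    G.abs_value_le (fun s => hlam _) (fun s₁ a b' => (hr s₁).abs_le (a, b')) s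
  obtain ⟨v, hv⟩ := (G.signDetermined_value r χ s).exists_isIteratedLimit hbd
  refine ⟨v, hv, ?_⟩
  have hmem := discountFactors_mem_smallRegion S A B b ε d
  have hR := iteratedEventually_mem_smallRegion (Nat.card S * stratBound S A B) d
    (Real.exp_pos (-(expBound S A B b ε : ℝ)))
  have hv₀ := abs_le.1 (hbd _ (smallRegion_subset_Ioc hmem))
  set v₀ := G.value r (fun s' => discountFactors S A B b ε (χ s')) s with hv₀_def
  have hden : (0 : ℝ) < ε.den := by exact_mod_cast ε.den_pos
  -- Both levels `m / ε.den` and `(m + 1) / ε.den` are tested; the second is why numerators up to `2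
  -- ^ b * ε.den + 1` are allowed.
  set m := ⌊v₀ * ε.den⌋
  have hm1 : (m : ℝ) ≤ v₀ * ε.den := Int.floor_le _
  have hm2 : v₀ * ε.den < m + 1 := Int.lt_floor_add_one _
  have hm3 : (m : ℝ) ≤ 2 ^ b * ε.den := hm1.trans (mul_le_mul_of_nonneg_right hv₀.2 hden.le)
  have hm4 : -(2 ^ b * ε.den : ℝ) < m + 1 := by
    nlinarith [mul_le_mul_of_nonneg_right hv₀.1 hden.le]
  have hm5 : m ≤ 2 ^ b * ε.den := by exact_mod_cast hm3
  have hm6 : -(2 ^ b * ε.den : ℤ) < m + 1 := by exact_mod_cast hm4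
  have hlow : (m / ε.den : ℝ) ≤ v := hv.le_of_iteratedEventually (hR.mono fun mu hmu =>
    G.le_value_of_mem_smallRegion hδ hr χ s ε (abs_le.2 ⟨by linarith, by linarith⟩) hmem hmu
      ((div_le_iff₀ hden).2 hm1))
  -- A point of the region with value above the upper level would force `v₀` to reach that level
  -- too, against the choice of the floor.
  have hup : v ≤ ((m + 1 : ℤ) / ε.den : ℝ) := hv.ge_of_iteratedEventually (hR.mono fun mu hmu => by
    by_contra! hlt
    have h := G.le_value_of_mem_smallRegion hδ hr χ s ε (zn := m + 1)
      (abs_le.2 ⟨by linarith, by linarith⟩) hmu hmem hlt.le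
    rw [← hv₀_def, div_le_iff₀ hden] at h
    push_cast at h
    linarith)
  have hε' : (1 / ε.den : ℝ) ≤ ε := by
    rw [Rat.cast_def]
    refine div_le_div_of_nonneg_right ?_ hden.le
    exact_mod_cast Rat.num_pos.2 hε
  have h1 : (m / ε.den : ℝ) ≤ v₀ := (div_le_iff₀ hden).2 hm1
  have h2 : v₀ ≤ ((m + 1 : ℤ) / ε.den : ℝ) := by
    rw [le_div_iff₀ hden]
    push_cast
    exact hm2.le
  have h3 : ((m + 1 : ℤ) / ε.den : ℝ) = m / ε.den + 1 / ε.den := by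
    push_cast
    ring
  rw [abs_le]
  constructor <;> linarith
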